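/- Let $n\ge 0$ and $R=\mathbb{C}[x_1,\dots,x_n,y_1,\dots,y_n]$. The group $S_n\times S_n$ acts on $R$ by $(\sigma,\tau)x_i=x_{\sigma(i)}$, $(\sigma,\tau)y_i=y_{\tau(i)}$, and $S_n$ acts diagonally, $\sigma\mapsto(\sigma,\sigma)$. Let $\mathcal{I}$ be the ideal of $R$ generated by the $S_n\times S_n$-invariant polynomials without constant term, and let $$\mathcal{H}_{S_n\times S_n}=\mathcal{I}^{\perp}=\{Q\in R : \langle P,Q\rangle=0 \text{ for all } P\in\mathcal{I}\},\qquad \langle P,Q\rangle=P(\partial)Q\,\big|_{\mathbf{x}=\mathbf{y}=0},$$ be the space of $S_n\times S_n$-harmonics, where $P(\partial)$ is obtained from $P$ by replacing each variable by the partial derivative with respect to it. It is a bihomogeneous submodule of $R$, invariant under the diagonal action. For a bihomogeneous submodule $\mathcal{V}\subseteq R$ invariant under the diagonal action, let $\mathcal{V}_{j,k}$ be its component of degree $j$ in $\mathbf{x}$ and degree $k$ in $\mathbf{y}$, with $S_n$-character $\chi_{\mathcal{V}_{j,k}}$. Its bigraded Frobenius characteristic is $$\mathcal{F}_{\mathcal{V}}(\mathbf{z};q,t)=\sum_{j,k\ge0}q^jt^k\,\frac{1}{n!}\sum_{\sigma\in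 S_n}\chi_{\mathcal{V}_{j,k}}(\sigma)\,p_{\lambda(\sigma)}(\mathbf{z}),$$ where $\lambda(\sigma)$ is the cycle type of $\sigma$ and $p_\lambda=p_{\lambda_1}p_{\lambda_2}\cdots$ with $p_i(\mathbf{z})=z_1^i+z_2^i+\cdots$ in infinitely many variables $\mathbf{z}=z_1,z_2,\dots$ For a symmetric function $g=\sum_\mu g_\mu p_\mu$ put $$g\Big[\frac{\mathbf{z}}{(1-q)(1-t)}\Big]=\sum_\mu g_\mu\prod_i\frac{p_{\mu_i}(\mathbf{z})}{(1-q^{\mu_i})(1-t^{\mu_i})},$$ let $h_n$ be the complete homogeneous symmetric function, and $(q;q)_n=(1-q)(1-q^2)\cdots(1-q^n)$. **Theorem.** For all $n$, as symmetric functions in $\mathbf{z}$ with coefficients in $\mathbb{C}[[q,t]]$, $$F_n(\mathbf{z};q,t):=\mathcal{F}_{\mathcal{H}_{S_n\times S_n}}(\mathbf{z};q,t)=(q;q)_n\,(t;t)_n\;h_n\Big[\frac{\mathbf{z}}{(1-q)(1-t)}\Big].$$ -/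

import Mathlib

open MvPolynomial in
/-- Over a field of characteristic zero, the power sums `p_1, …, p_N` in `N` variables are
algebraically independent. -/
theorem BigradedFrobenius.aeval_psum_injective_field (L : Type*) [Field L] [CharZero L] (N : ℕ) :
    Function.Injective
      (aeval (fun i : Fin N => psum (Fin N) L (i + 1)) :
        MvPolynomial (Fin N) L →ₐ[L] MvPolynomial (Fin N) L) := by
  classical
  set φ : MvPolynomial (Fin N) L →ₐ[L] MvPolynomial (Fin N) L :=
    aeval (fun i : Fin N => psum (Fin N) L (i + 1)) with hφ
  have hp : ∀ k, 1 ≤ k → k ≤ N → psum (Fin N) L k ∈ φ.range := by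
    intro k h1 h2
    refine ⟨X ⟨k - 1, by omega⟩, ?_⟩
    simp [hφ, Nat.sub_add_cancel h1]
  have he : ∀ k, k ≤ N → esymm (Fin N) L k ∈ φ.range := by
    intro k
    induction k using Nat.strong_induction_on with
    | _ k ih =>
      intro hk
      rcases Nat.eq_zero_or_pos k with rfl | hpos
      · rw [esymm_zero]; exact Subalgebra.one_mem _
      have hN := mul_esymm_eq_sum (Fin N) L k
      have hmem : (k : MvPolynomial (Fin N) L) * esymm (Fin N) L k ∈ φ.range := by
        rw [hN]
        refine Subalgebra.mul_mem _ (Subalgebra.pow_mem _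
          (Subalgebra.neg_mem _ (Subalgebra.one_mem _)) _) (Subalgebra.sum_mem _ ?_)
        intro a ha
        rw [Finset.mem_filter, Finset.HasAntidiagonal.mem_antidiagonal] at ha
        refine Subalgebra.mul_mem _ (Subalgebra.mul_mem _ (Subalgebra.pow_mem _
          (Subalgebra.neg_mem _ (Subalgebra.one_mem _)) _) (ih _ ha.2 (by omega)))
          (hp _ (by omega) (by omega))
      have h3 := Subalgebra.smul_mem φ.range hmem ((k : L)⁻¹)
      have hk0 : (k : L) ≠ 0 := by exact_mod_cast hpos.ne'
      have h4 : ((k : L)⁻¹) • ((k : MvPolynomial (Fin N) L) * esymm (Fin N) L k)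
          = esymm (Fin N) L k := by
        rw [← nsmul_eq_mul, ← Nat.cast_smul_eq_nsmul L, smul_smul, inv_mul_cancel₀ hk0, one_smul]
      rwa [h4] at h3
  let ε := AlgEquiv.ofBijective _ (esymmAlgHom_fin_bijective L N)
  have hsym : ∀ P, φ P ∈ symmetricSubalgebra (Fin N) L := by
    intro P
    have : φ.range ≤ symmetricSubalgebra (Fin N) L := by
      rw [hφ, ← Algebra.adjoin_range_eq_range_aeval, Algebra.adjoin_le_iff]
      rintro _ ⟨i, rfl⟩
      exact psum_isSymmetric (Fin N) L _
    exact this ⟨P, rfl⟩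
  let φ' : MvPolynomial (Fin N) L →ₐ[L] symmetricSubalgebra (Fin N) L := φ.codRestrict _ hsym
  let ψ : MvPolynomial (Fin N) L →ₐ[L] MvPolynomial (Fin N) L := ε.symm.toAlgHom.comp φ'
  have hψ : Function.Surjective ψ := by
    refine ε.symm.surjective.comp ?_
    intro s
    obtain ⟨Q, rfl⟩ := ε.surjective s
    have hle : ∀ Q, (ε Q : MvPolynomial (Fin N) L) ∈ φ.range := by
      intro Q
      have : (ε Q : MvPolynomial (Fin N) L) = aeval (fun i : Fin N => esymm (Fin N) L (i + 1)) Q :=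
        esymmAlgHom_apply Q
      rw [this]
      have h2 : (aeval (fun i : Fin N => esymm (Fin N) L (i + 1))).range ≤ φ.range := by
        rw [← Algebra.adjoin_range_eq_range_aeval, Algebra.adjoin_le_iff]
        rintro _ ⟨i, rfl⟩
        exact he _ (by omega)
      exact h2 ⟨Q, rfl⟩
    obtain ⟨P, hP⟩ := hle Q
    exact ⟨P, Subtype.ext hP⟩
  -- a surjective endomorphism of a Noetherian ring is injective
  have hinj : Function.Injective ψ := by
    rw [injective_iff_map_eq_zero]
    intro P hP
    let f : ℕ →o Ideal (MvPolynomial (Fin N) L) :=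
      ⟨fun m => RingHom.ker ((ψ ^ m : MvPolynomial (Fin N) L →ₐ[L] MvPolynomial (Fin N) L)), by
        refine monotone_nat_of_le_succ ?_
        intro m x hx
        rw [RingHom.mem_ker] at hx ⊢
        rw [pow_succ', AlgHom.mul_apply, hx, map_zero]⟩
    obtain ⟨m, hm⟩ := monotone_stabilizes_iff_noetherian.mpr
      (inferInstance : IsNoetherianRing (MvPolynomial (Fin N) L)) f
    have hsurj : Function.Surjective (ψ ^ m : MvPolynomial (Fin N) L →ₐ[L] _) := by
      rw [AlgHom.coe_pow]
      exact hψ.iterate m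
    obtain ⟨Q, rfl⟩ := hsurj P
    have h1 : Q ∈ f (m + 1) := by
      change _ ∈ RingHom.ker _
      rw [RingHom.mem_ker, pow_succ', AlgHom.mul_apply, hP]
    rw [← hm (m + 1) (Nat.le_succ m)] at h1
    exact h1
  intro P Q hPQ
  apply hinj
  change ε.symm (φ' P) = ε.symm (φ' Q)
  congr 1
  exact Subtype.ext hPQ

noncomputable section

namespace BigradedFrobenius

/-! ### Symmetric functions in the variables `z_0, z_1, z_2, …` -/

/-- The power sum `p_i(z) = z_0^i + z_1^i + ⋯` (for `i ≥ 1`), as a formal power series in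
infinitely many variables. -/
def powerSum (K : Type*) [CommRing K] (i : ℕ) : MvPowerSeries ℕ K :=
  open Classical in fun m => if ∃ j, m = Finsupp.single j i then 1 else 0

/-- The product `p_{λ_1} p_{λ_2} ⋯` over the parts of a partition (given by its multiset of
parts). -/
def powerSumPart (K : Type*) [CommRing K] (s : Multiset ℕ) : MvPowerSeries ℕ K :=
  (s.map (powerSum K)).prod

/-- The complete homogeneous symmetric function `h_n(z)`, the sum of all monomials of degree
`n`. -/
def completeSeries (K : Type*) [CommRing K] (n : ℕ) : MvPowerSeries ℕ K :=
  fun m => if m.degree = n then 1 else 0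

/-- The algebra map sending the formal variable with index `i` to the power sum `p_{i+1}`. -/
def powerSumHom (K : Type*) [CommRing K] : MvPolynomial ℕ K →ₐ[K] MvPowerSeries ℕ K :=
  MvPolynomial.aeval fun i => powerSum K (i + 1)

/-- The algebra of symmetric functions over a ring `K` containing `ℚ`: all power series that are
(finite) linear combinations of products of power sums. -/
def SymmFun (K : Type*) [CommRing K] : Subalgebra K (MvPowerSeries ℕ K) :=
  (powerSumHom K).range

theorem killCompl_powerSum (K : Type*) [CommRing K] (N i : ℕ) (e : Fin N ↪ ℕ) :
    MvPowerSeries.killCompl e (powerSum K (i + 1)) =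
      ((MvPolynomial.psum (Fin N) K (i + 1) : MvPolynomial (Fin N) K) :
        MvPowerSeries (Fin N) K) := by
  classical
  ext m
  rw [MvPowerSeries.coeff_killCompl, MvPolynomial.coeff_coe, MvPolynomial.psum,
    MvPolynomial.coeff_sum]
  simp only [MvPolynomial.coeff_X_pow]
  change (if ∃ j, Finsupp.embDomain e m = Finsupp.single j (i + 1) then (1 : K) else 0) = _
  by_cases h : ∃ j, Finsupp.single j (i + 1) = m
  · obtain ⟨j, rfl⟩ := h
    rw [if_pos ⟨e j, by rw [Finsupp.embDomain_single]⟩, Finset.sum_eq_single j]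
    · simp
    · intro k _ hk
      rw [if_neg]
      intro h
      exact hk ((Finsupp.single_left_inj (Nat.succ_ne_zero i)).mp h)
    · simp
  · rw [if_neg, Finset.sum_eq_zero]
    · intro k _
      exact if_neg fun hk => h ⟨k, hk⟩
    · rintro ⟨j, hj⟩
      by_cases hjr : j ∈ Set.range e
      · obtain ⟨k, rfl⟩ := hjr
        apply h
        refine ⟨k, Finsupp.embDomain_injective e ?_⟩
        rw [hj, Finsupp.embDomain_single]
      · have := DFunLike.congr_fun hj j
        rw [Finsupp.embDomain_of_notMem_range _ _ _ hjr] at this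
        simp at this

/-- The power sums are algebraically independent, so the expansion of a symmetric function in the
`p_μ` is unique. -/
theorem powerSumHom_injective (K : Type*) [CommRing K] [IsDomain K] [CharZero K] :
    Function.Injective (powerSumHom K) := by
  rw [injective_iff_map_eq_zero]
  intro P hP
  obtain ⟨N, hN⟩ : ∃ N, ∀ i ∈ P.vars, i < N :=
    ⟨P.vars.sup id + 1, fun i hi => Nat.lt_succ_of_le (Finset.le_sup (f := id) hi)⟩
  obtain ⟨Q, rfl⟩ : ∃ Q : MvPolynomial (Fin N) K, MvPolynomial.rename Fin.val Q = P := by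
    have hmem : P ∈ MvPolynomial.supported K (Set.range (Fin.val : Fin N → ℕ)) := by
      rw [MvPolynomial.mem_supported]
      intro i hi
      exact ⟨⟨i, hN i hi⟩, rfl⟩
    rw [MvPolynomial.supported_eq_range_rename] at hmem
    obtain ⟨Q, hQ⟩ := hmem
    let r : Set.range (Fin.val : Fin N → ℕ) → Fin N :=
      fun x => ⟨x, by obtain ⟨_, y, rfl⟩ := x; exact y.2⟩
    refine ⟨MvPolynomial.rename r Q, ?_⟩
    rw [MvPolynomial.rename_rename, ← hQ]
    rfl
  have h1 : MvPowerSeries.killCompl (Fin.valEmbedding : Fin N ↪ ℕ)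
      (powerSumHom K (MvPolynomial.rename Fin.val Q)) = 0 := by rw [hP, map_zero]
  have h2 : ∀ Q : MvPolynomial (Fin N) K, MvPowerSeries.killCompl (Fin.valEmbedding : Fin N ↪ ℕ)
      (powerSumHom K (MvPolynomial.rename Fin.val Q)) =
      ((MvPolynomial.aeval (fun i : Fin N => MvPolynomial.psum (Fin N) K (i + 1)) Q :
        MvPolynomial (Fin N) K) : MvPowerSeries (Fin N) K) := by
    intro Q
    have : ((MvPowerSeries.killCompl (R := K) (Fin.valEmbedding : Fin N ↪ ℕ)).comp
        (powerSumHom K)).comp (MvPolynomial.rename Fin.val) =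
        (MvPolynomial.coeToMvPowerSeries.algHom K).comp
          (MvPolynomial.aeval (fun i : Fin N => MvPolynomial.psum (Fin N) K (i + 1))) := by
      ext1 i
      simp [powerSumHom, killCompl_powerSum]
    simpa using DFunLike.congr_fun this Q
  rw [h2, ← MvPolynomial.coe_zero, MvPolynomial.coe_inj] at h1
  let L := FractionRing K
  have : CharZero L := charZero_of_injective_algebraMap (IsFractionRing.injective K L)
  have h3 : Q = 0 := by
    apply MvPolynomial.map_injective _ (IsFractionRing.injective K L)
    rw [map_zero]
    apply aeval_psum_injective_field L N
    rw [map_zero]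
    have h4 := congrArg (MvPolynomial.map (algebraMap K L)) h1
    rw [map_zero, MvPolynomial.map_aeval] at h4
    rw [MvPolynomial.aeval_def, MvPolynomial.eval₂_map]
    have h5 : (algebraMap L (MvPolynomial (Fin N) L)).comp (algebraMap K L) =
        (MvPolynomial.map (algebraMap K L)).comp (algebraMap K (MvPolynomial (Fin N) K)) := by
      ext x
      simp [MvPolynomial.algebraMap_eq]
    rw [h5]
    simpa [MvPolynomial.psum] using h4
  rw [h3, map_zero]

theorem coeff_powerSum_mul_completeSeries (K : Type*) [CommRing K] (i k : ℕ) (m : ℕ →₀ ℕ) :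
    MvPowerSeries.coeff m (powerSum K (i + 1) * completeSeries K k) =
      if m.degree = k + (i + 1) then ((m.support.filter (fun j => i < m j)).card : K) else 0 := by
  classical
  rw [MvPowerSeries.coeff_mul]
  change ∑ p ∈ Finset.HasAntidiagonal.antidiagonal m, (if ∃ j, p.1 = Finsupp.single j (i + 1) then (1 : K) else 0) *
    (if p.2.degree = k then 1 else 0) = _
  simp only [← ite_and, ite_mul, one_mul, zero_mul, Finset.sum_ite, Finset.sum_const_zero, add_zero,
    Finset.sum_const, nsmul_eq_mul, mul_one]
  split_ifs with h
  · congr 1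
    symm
    refine Finset.card_bij (fun j _ => (Finsupp.single j (i + 1), m - Finsupp.single j (i + 1)))
      ?_ ?_ ?_
    · intro j hj
      rw [Finset.mem_filter] at hj
      have hle : Finsupp.single j (i + 1) ≤ m := Finsupp.single_le_iff.mpr hj.2
      rw [Finset.mem_filter, Finset.HasAntidiagonal.mem_antidiagonal]
      have hadd := add_tsub_cancel_of_le hle
      refine ⟨hadd, ⟨j, rfl⟩, ?_⟩
      have := congrArg Finsupp.degree hadd
      rw [map_add, Finsupp.degree_single, h] at this
      change (m - Finsupp.single j (i + 1)).degree = k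
      omega
    · intro a _ b _ hab
      exact (Finsupp.single_left_inj (Nat.succ_ne_zero i)).mp (Prod.ext_iff.mp hab).1
    · rintro ⟨a, b⟩ hab
      rw [Finset.mem_filter, Finset.HasAntidiagonal.mem_antidiagonal] at hab
      obtain ⟨hadd, ⟨j, hj⟩, -⟩ := hab
      dsimp only at hadd hj
      subst hj
      have hmj : i + 1 ≤ m j := by
        rw [← hadd]; simp
      refine ⟨j, Finset.mem_filter.mpr ⟨Finsupp.mem_support_iff.mpr (by omega), hmj⟩, ?_⟩
      rw [← hadd, add_tsub_cancel_left]
  · rw [Finset.filter_false_of_mem, Finset.card_empty, Nat.cast_zero]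
    rintro ⟨a, b⟩ hab ⟨⟨j, hj⟩, hb⟩
    rw [Finset.HasAntidiagonal.mem_antidiagonal] at hab
    dsimp only at hab hj hb
    apply h
    rw [← hab, map_add, hj, hb, Finsupp.degree_single, add_comm]

/-- Newton's identity `n h_n = ∑_{i=1}^n p_i h_{n-i}`. -/
theorem newton_completeSeries (K : Type*) [CommRing K] (n : ℕ) :
    (n : K) • completeSeries K n =
      ∑ i ∈ Finset.range n, powerSum K (i + 1) * completeSeries K (n - (i + 1)) := by
  classical
  ext m
  rw [map_sum, MvPowerSeries.coeff_smul]
  change (n : K) * (if m.degree = n then (1 : K) else 0) = _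
  have h1 : ∀ i ∈ Finset.range n,
      MvPowerSeries.coeff m (powerSum K (i + 1) * completeSeries K (n - (i + 1))) =
      if m.degree = n then ((m.support.filter (fun j => i < m j)).card : K) else 0 := by
    intro i hi
    rw [Finset.mem_range] at hi
    rw [coeff_powerSum_mul_completeSeries, Nat.sub_add_cancel hi]
  rw [Finset.sum_congr rfl h1]
  split_ifs with h
  · rw [mul_one, ← Nat.cast_sum]
    congr 1
    simp only [Finset.card_filter]
    rw [Finset.sum_comm]
    rw [← h, Finsupp.degree_apply]
    refine Finset.sum_congr rfl fun j hj => ?_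
    have hle : m j ≤ ∑ i ∈ m.support, m i :=
      Finset.single_le_sum (f := fun i => m i) (fun _ _ => Nat.zero_le _) hj
    rw [← Finset.card_filter]
    have : (Finset.range (∑ i ∈ m.support, m i)).filter (fun i => i < m j) =
        Finset.range (m j) := by
      ext i
      simp only [Finset.mem_filter, Finset.mem_range]
      omega
    rw [this, Finset.card_range]
  · simp

theorem completeSeries_mem (K : Type*) [CommRing K] [Algebra ℚ K] (n : ℕ) :
    completeSeries K n ∈ SymmFun K := by
  induction n using Nat.strong_induction_on with
  | _ n ih =>
    rcases Nat.eq_zero_or_pos n with rfl | hpos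
    · have : completeSeries K 0 = 1 := by
        classical
        ext m
        rw [MvPowerSeries.coeff_one]
        change (if m.degree = 0 then (1 : K) else 0) = _
        simp [Finsupp.degree_eq_zero_iff]
      rw [this]
      exact Subalgebra.one_mem _
    have hmem : (n : K) • completeSeries K n ∈ SymmFun K := by
      rw [newton_completeSeries]
      refine Subalgebra.sum_mem _ fun i hi => Subalgebra.mul_mem _ ⟨MvPolynomial.X i, ?_⟩
        (ih _ (by rw [Finset.mem_range] at hi; omega))
      simp [powerSumHom]
    have h2 := Subalgebra.smul_mem _ hmem (algebraMap ℚ K (n : ℚ)⁻¹)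
    have h3 : algebraMap ℚ K (n : ℚ)⁻¹ * (n : K) = 1 := by
      rw [← map_natCast (algebraMap ℚ K), ← map_mul,
        inv_mul_cancel₀ (by exact_mod_cast hpos.ne'), map_one]
    rwa [smul_smul, h3, one_smul] at h2

/-! ### Plethysm -/

/-- The ring `ℂ⟦q, t⟧` of formal power series in two variables. -/
abbrev QT : Type := MvPowerSeries (Fin 2) ℂ

/-- The variable `q`. -/
def q : QT := MvPowerSeries.X 0

/-- The variable `t`. -/
def t : QT := MvPowerSeries.X 1

/-- `(u; u)_n = (1 - u)(1 - u ^ 2) ⋯ (1 - u ^ n)`. -/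
def qPoch (u : QT) (n : ℕ) : QT := ∏ i ∈ Finset.range n, (1 - u ^ (i + 1))

/-- `h_n` as an element of the algebra of symmetric functions over `ℂ⟦q, t⟧`. -/
def complete (n : ℕ) : SymmFun QT :=
  ⟨completeSeries QT n, completeSeries_mem QT n⟩

instance : IsDomain QT := NoZeroDivisors.to_isDomain QT

instance : CharZero QT := algebraRat.charZero QT

/-- The algebra of symmetric functions is the polynomial algebra on the power sums. -/
def powerSumEquiv : MvPolynomial ℕ QT ≃ₐ[QT] SymmFun QT :=
  AlgEquiv.ofInjective (powerSumHom QT) (powerSumHom_injective QT)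

/-- The plethysm `g ↦ g[z / ((1 - q)(1 - t))]`: for `g = ∑_μ g_μ p_μ` this is
`∑_μ g_μ ∏_i p_{μ_i} / ((1 - q ^ μ_i)(1 - t ^ μ_i))`. -/
def plethysm : SymmFun QT →ₐ[QT] MvPowerSeries ℕ QT :=
  (MvPolynomial.aeval fun i : ℕ =>
    ((1 - q ^ (i + 1)) * (1 - t ^ (i + 1)))⁻¹ • powerSum QT (i + 1)).comp
      powerSumEquiv.symm.toAlgHom

/-! ### The polynomial ring `R = ℂ[x, y]` with its group actions -/

/-- `ℂ[x_1, …, x_n, y_1, …, y_n]`: the variable `x_i` has index `Sum.inl i`, and `y_i` has index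
`Sum.inr i`. -/
abbrev R (n : ℕ) : Type := MvPolynomial (Fin n ⊕ Fin n) ℂ

/-- `S_n × S_n` acts on `R` by `(σ, τ) x_i = x_{σ i}` and `(σ, τ) y_i = y_{τ i}`. -/
def action (n : ℕ) :
    Representation ℂ (Equiv.Perm (Fin n) × Equiv.Perm (Fin n)) (R n) where
  toFun g := (MvPolynomial.rename (Sum.map g.1 g.2)).toLinearMap
  map_one' := by
    refine LinearMap.ext fun P => ?_
    simp
  map_mul' g h := by
    refine LinearMap.ext fun P => ?_
    simp [MvPolynomial.rename_rename, Sum.map_comp_map]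

/-- The diagonal action of `S_n` on `R`. -/
def diagonalAction (n : ℕ) : Representation ℂ (Equiv.Perm (Fin n)) (R n) :=
  (action n).comp ((MonoidHom.id _).prod (MonoidHom.id _))

/-- The ideal of `R` generated by the `S_n × S_n`-invariant polynomials without constant term. -/
def invariantIdeal (n : ℕ) : Ideal (R n) :=
  Ideal.span {P | (∀ g, action n g P = P) ∧ MvPolynomial.constantCoeff P = 0}

theorem pderiv_commute (n : ℕ) (i j : Fin n ⊕ Fin n) :
    Commute ((MvPolynomial.pderiv (R := ℂ) i).toLinearMap : Module.End ℂ (R n))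
      (MvPolynomial.pderiv (R := ℂ) j).toLinearMap := by
  have h : ⁅(MvPolynomial.pderiv i : Derivation ℂ (R n) (R n)),
      (MvPolynomial.pderiv j : Derivation ℂ (R n) (R n))⁆ = 0 := by
    classical
    apply MvPolynomial.derivation_ext
    intro k
    rw [Derivation.commutator_apply]
    simp [MvPolynomial.pderiv_X, Pi.single_apply, apply_ite]
  refine LinearMap.ext fun P => ?_
  have := DFunLike.congr_fun h P
  rw [Derivation.commutator_apply] at this
  exact sub_eq_zero.mp this

/-- The iterated partial derivative `∏_v ∂_v ^ (m v)` attached to an exponent vector `m`. -/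
def iteratedPartial (n : ℕ) (m : (Fin n ⊕ Fin n) →₀ ℕ) : Module.End ℂ (R n) :=
  Finset.univ.noncommProd (fun v => (MvPolynomial.pderiv (R := ℂ) v).toLinearMap ^ m v)
    fun i _ j _ _ => (pderiv_commute n i j).pow_pow _ _

/-- The differential operator `P(∂)`, obtained from `P` by replacing every variable with the
partial derivative with respect to it. -/
def diffOp (n : ℕ) (P : R n) : Module.End ℂ (R n) :=
  ∑ m ∈ P.support, P.coeff m • iteratedPartial n m

/-- The scalar product `⟨P, Q⟩ = P(∂) Q |_{x = y = 0}`. -/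
def scalarProduct (n : ℕ) (P Q : R n) : ℂ :=
  MvPolynomial.eval 0 (diffOp n P Q)

theorem noncommProd_intertwine {ι W : Type*} [AddCommGroup W] [Module ℂ W] (T : W →ₗ[ℂ] W)
    (e : Equiv.Perm ι) (f g : ι → Module.End ℂ W) (hfg : ∀ v Q, g (e v) (T Q) = T (f v Q))
    (s s' : Finset ι) (hs : s' = s.map e.toEmbedding)
    (hg : (s' : Set ι).Pairwise (Function.onFun Commute g))
    (hf : (s : Set ι).Pairwise (Function.onFun Commute f)) (Q : W) :
    s'.noncommProd g hg (T Q) = T (s.noncommProd f hf Q) := by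
  classical
  induction s using Finset.induction_on generalizing s' Q with
  | empty =>
    rw [Finset.map_empty] at hs
    subst hs
    rw [Finset.noncommProd_empty, Finset.noncommProd_empty]
    rfl
  | insert a s ha ih =>
    rw [Finset.map_insert] at hs
    subst hs
    rw [Finset.noncommProd_insert_of_notMem _ _ _ _ (by simpa using ha),
      Finset.noncommProd_insert_of_notMem _ _ _ _ ha, Module.End.mul_apply,
      Module.End.mul_apply, ih _ rfl, ← hfg]
    rfl

theorem diffOp_rename (n : ℕ) (e : Equiv.Perm (Fin n ⊕ Fin n)) (P Q : R n) :
    diffOp n (MvPolynomial.rename e P) (MvPolynomial.rename e Q) =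
      MvPolynomial.rename e (diffOp n P Q) := by
  classical
  have hpow : ∀ (v : Fin n ⊕ Fin n) (k : ℕ) (Q : R n),
      ((MvPolynomial.pderiv (R := ℂ) (e v)).toLinearMap ^ k : Module.End ℂ (R n))
        (MvPolynomial.rename e Q) = MvPolynomial.rename e
          (((MvPolynomial.pderiv (R := ℂ) v).toLinearMap ^ k : Module.End ℂ (R n)) Q) := by
    intro v k
    induction k with
    | zero => intro Q; simp
    | succ k ih =>
      intro Q
      rw [pow_succ, pow_succ, Module.End.mul_apply, Module.End.mul_apply, ← ih]
      congr 1
      exact MvPolynomial.pderiv_rename e.injective v Q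
  have hpart' : ∀ (m : (Fin n ⊕ Fin n) →₀ ℕ) (Q : R n),
      iteratedPartial n (m.mapDomain e) (MvPolynomial.rename e Q) =
        MvPolynomial.rename e (iteratedPartial n m Q) := by
    intro m Q
    refine noncommProd_intertwine (MvPolynomial.rename (R := ℂ) e).toLinearMap e _ _ ?_
      Finset.univ Finset.univ (Finset.map_univ_equiv e).symm _ _ Q
    intro v Q
    rw [Finsupp.mapDomain_apply e.injective]
    exact hpow v _ Q
  unfold diffOp
  rw [MvPolynomial.support_rename_of_injective e.injective, Finset.sum_image
    (fun a _ b _ hab => Finsupp.mapDomain_injective e.injective hab)]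
  simp only [LinearMap.sum_apply, LinearMap.smul_apply, map_sum, map_smul, hpart',
    MvPolynomial.coeff_rename_mapDomain _ e.injective]

theorem diagonalAction_apply (n : ℕ) (σ : Equiv.Perm (Fin n)) (P : R n) :
    diagonalAction n σ P = MvPolynomial.rename (Equiv.sumCongr σ σ) P :=
  rfl

theorem scalarProduct_diagonalAction (n : ℕ) (σ : Equiv.Perm (Fin n)) (P Q : R n) :
    scalarProduct n (diagonalAction n σ P) (diagonalAction n σ Q) = scalarProduct n P Q := by
  rw [scalarProduct, diagonalAction_apply, diagonalAction_apply, diffOp_rename,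
    MvPolynomial.eval_rename]
  rfl

theorem diagonalAction_mem_invariantIdeal (n : ℕ) (σ : Equiv.Perm (Fin n)) {P : R n}
    (hP : P ∈ invariantIdeal n) : diagonalAction n σ P ∈ invariantIdeal n := by
  have hle : invariantIdeal n ≤ (invariantIdeal n).comap
      (MvPolynomial.rename (R := ℂ) (Equiv.sumCongr σ σ)).toRingHom := by
    refine Ideal.span_le.mpr ?_
    rintro P ⟨hP, h0⟩
    have : MvPolynomial.rename (Equiv.sumCongr σ σ) P = P := hP (σ, σ)
    change MvPolynomial.rename (Equiv.sumCongr σ σ) P ∈ invariantIdeal n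
    rw [this]
    exact Ideal.subset_span ⟨hP, h0⟩
  exact hle hP

/-- The space of `S_n × S_n`-harmonic polynomials: the orthogonal complement of the invariant ideal,
as an `S_n`-submodule of `R` for the diagonal action. -/
def harmonics (n : ℕ) : Subrepresentation (diagonalAction n) where
  toSubmodule :=
    { carrier := {Q | ∀ P ∈ invariantIdeal n, scalarProduct n P Q = 0}
      add_mem' := by
        intro a b ha hb P hP
        have h1 := ha P hP
        have h2 := hb P hP
        simp only [scalarProduct, map_add] at h1 h2 ⊢
        rw [h1, h2, add_zero]
      zero_mem' := by
        intro P _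
        simp [scalarProduct]
      smul_mem' := by
        intro c a ha P hP
        have h1 := ha P hP
        simp only [scalarProduct, map_smul, MvPolynomial.smul_eval] at h1 ⊢
        rw [h1, mul_zero] }
  apply_mem_toSubmodule := by
    intro σ Q hQ P hP
    have h1 := hQ _ (diagonalAction_mem_invariantIdeal n σ⁻¹ hP)
    rw [← scalarProduct_diagonalAction n σ, ← Module.End.mul_apply, ← map_mul, mul_inv_cancel,
      map_one] at h1
    exact h1

/-! ### The bigraded Frobenius characteristic -/

/-- The projection `π_{j,k}` of `R` onto its component of bidegree `(j, k)`. -/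
def bidegreeProj (n j k : ℕ) : R n →ₗ[ℂ] R n :=
  MvPolynomial.weightedHomogeneousComponent
    (Sum.elim (fun _ => (1, 0)) (fun _ => (0, 1)) : Fin n ⊕ Fin n → ℕ × ℕ) (j, k)

theorem bidegreeProj_diagonalAction (n j k : ℕ) (σ : Equiv.Perm (Fin n)) (P : R n) :
    bidegreeProj n j k (diagonalAction n σ P) = diagonalAction n σ (bidegreeProj n j k P) := by
  rw [diagonalAction_apply, diagonalAction_apply]
  ext m
  obtain ⟨m, rfl⟩ := (Finsupp.mapDomain_surjective (M := ℕ) (Equiv.sumCongr σ σ).surjective) m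
  rw [bidegreeProj, MvPolynomial.coeff_weightedHomogeneousComponent,
    MvPolynomial.coeff_rename_mapDomain _ (Equiv.injective _),
    MvPolynomial.coeff_rename_mapDomain _ (Equiv.injective _),
    MvPolynomial.coeff_weightedHomogeneousComponent]
  have hw : ∀ m : (Fin n ⊕ Fin n) →₀ ℕ,
      Finsupp.weight (Sum.elim (fun _ => (1, 0)) (fun _ => (0, 1)) : Fin n ⊕ Fin n → ℕ × ℕ)
        (m.mapDomain (Equiv.sumCongr σ σ)) =
      Finsupp.weight (Sum.elim (fun _ => (1, 0)) (fun _ => (0, 1)) : Fin n ⊕ Fin n → ℕ × ℕ) m := by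
    intro m
    rw [Finsupp.weight_apply, Finsupp.weight_apply, Finsupp.sum_mapDomain_index_inj
      (Equiv.injective _)]
    refine Finsupp.sum_congr fun v _ => ?_
    rcases v with v | v <;> simp
  rw [hw]

/-- The bihomogeneous component `V_{j,k} = π_{j,k}(V)`, as an `S_n`-module. -/
def component {n : ℕ} (V : Subrepresentation (diagonalAction n)) (j k : ℕ) :
    Subrepresentation (diagonalAction n) where
  toSubmodule := V.toSubmodule.map (bidegreeProj n j k)
  apply_mem_toSubmodule := by
    rintro σ _ ⟨P, hP, rfl⟩
    exact ⟨diagonalAction n σ P, V.apply_mem_toSubmodule σ hP,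
      bidegreeProj_diagonalAction n j k σ P⟩

/-- The Frobenius characteristic `(1 / n!) ∑_σ χ(σ) p_{λ(σ)}` of a finite-dimensional
representation of `S_n`, where `λ(σ)` is the cycle type of `σ` (fixed points included). -/
def frobenius {n : ℕ} {W : Type*} [AddCommGroup W] [Module ℂ W]
    (ρ : Representation ℂ (Equiv.Perm (Fin n)) W) : MvPowerSeries ℕ ℂ :=
  ((n.factorial : ℂ)⁻¹) •
    ∑ σ : Equiv.Perm (Fin n), ρ.character σ • powerSumPart ℂ σ.partition.parts

/-- The bigraded Frobenius characteristic `∑_{j,k} q^j t^k F_{V_{j,k}}(z)`, as a power series in `z`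
with coefficients in `ℂ⟦q, t⟧`: the coefficient of `z^m q^j t^k` is the coefficient of `z^m` in the
Frobenius characteristic of `V_{j,k}`. -/
def bigradedFrobenius {n : ℕ} (V : Subrepresentation (diagonalAction n)) : MvPowerSeries ℕ QT :=
  fun m d => MvPowerSeries.coeff m (frobenius (component V (d 0) (d 1)).toRepresentation)

end BigradedFrobenius
end

/-! Both sides are compared after multiplication by `n!`, permutation by permutation. On the right,
`n! h_n = ∑_σ p_{λ(σ)}`, and the plethysm multiplies `p_{λ(σ)}` by the product of `1 / ((1 - q^l)(1
- t^l))` over the cycle lengths `l` of `σ`. Expanding the geometric series shows that this product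
counts, by bidegree, the monomials of `R` fixed by `σ`: such a monomial has constant `x`-exponents
and constant `y`-exponents along each cycle. So it is the graded trace of `σ` on `R`.

On the left, the graded character of the harmonics at `σ` must therefore equal `(q;q)_n (t;t)_n`
times that trace. In each bidegree the pairing is nondegenerate with the monomials as an orthogonal
basis, so the harmonics fit into an exact sequence with the whole component and the dual of the
component of `𝓘`. Up to replacing `σ` by `σ⁻¹`, which has the same fixed monomials, the character of
the harmonics is thus that of `R/𝓘` (`character_component_harmonics_eq_sub`).

The ideal `𝓘` is generated by the elementary symmetric polynomials in `x` and those in `y`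
(`invariantIdeal_eq`). These form a regular sequence of invariant bihomogeneous elements, and
dividing by such an element of bidegree `e` multiplies the trace series by `1 - X^e`
(`quotientTraceSeries_sup`). The bidegrees `(i, 0)` and `(0, i)` for `1 ≤ i ≤ n` give the two
products. Regularity comes from flatness of `R` over the polynomial ring on the elementary symmetric
polynomials (`flat_aeval_esymm_sum`), since the variables of that ring visibly form a regular
sequence. -/

/-! ### Regular elements under flat extension -/

/-- If `f : S → T` is flat and `a` is a nonzerodivisor modulo `I`, then `f a` is a nonzerodivisor
modulo the extension of `I`. -/
theorem RingHom.Flat.mem_map_of_mul_mem_map {S T : Type*} [CommRing S] [CommRing T] {f : S →+* T}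
    (hf : f.Flat) (I : Ideal S) (a : S) (ha : ∀ x, a * x ∈ I → x ∈ I) {r : T}
    (hr : f a * r ∈ I.map f) : r ∈ I.map f := by
  algebraize [f]
  have h1 : IsSMulRegular (S ⧸ I) a := by
    rw [isSMulRegular_iff_right_eq_zero_of_smul]
    intro x
    obtain ⟨x, rfl⟩ := Ideal.Quotient.mk_surjective x
    intro hx
    rw [Ideal.Quotient.eq_zero_iff_mem]
    apply ha
    rw [← Ideal.Quotient.eq_zero_iff_mem]
    exact hx
  -- Tensoring the injection `a : S/I → S/I` with the flat module `T` keeps it injective, and `T ⊗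
  -- S/I = T/IT`.
  have h2 : IsSMulRegular (T ⧸ (I • ⊤ : Submodule S T)) a :=
    ((TensorProduct.tensorQuotEquivQuotSMul T I).isSMulRegular_congr a).mp (h1.lTensor T)
  have h3 : ∀ z : T, z ∈ (I • ⊤ : Submodule S T) ↔ z ∈ I.map f := by
    intro z
    rw [Ideal.smul_top_eq_map]
    rfl
  rw [← h3]
  rw [isSMulRegular_iff_right_eq_zero_of_smul] at h2
  have h4 := h2 (Submodule.Quotient.mk r) (by
    rw [← Submodule.Quotient.mk_smul, Submodule.Quotient.mk_eq_zero, h3]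
    exact hr)
  rwa [Submodule.Quotient.mk_eq_zero] at h4

/-! ### Flatness over the elementary symmetric polynomials, and regularity -/

namespace MvPolynomial

section Step

variable (A : Type*) [CommRing A] (n : ℕ)

/-- The variables of a polynomial ring in `n` variables, indexed from `1` and preceded by `1`, as
a sequence that vanishes after the index `n`. -/
noncomputable def extendedX : ℕ → MvPolynomial (Fin n) A
  | 0 => 1
  | k + 1 => if h : k < n then X ⟨k, h⟩ else 0

variable {A n} in
theorem extendedX_succ_of_lt {k : ℕ} (h : k < n) : extendedX A n (k + 1) = X ⟨k, h⟩ :=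
  dif_pos h

theorem extendedX_succ_self : extendedX A n (n + 1) = 0 :=
  dif_neg (lt_irrefl n)

/-- The homomorphism `E_k ↦ E_k + T E_{k-1}`, describing how the elementary symmetric polynomials
change when a variable `T` is added. -/
noncomputable def adjoinVariable :
    MvPolynomial (Fin (n + 1)) A →ₐ[A] MvPolynomial (Fin n) (Polynomial A) :=
  aeval fun i => extendedX _ n (i + 1) + C Polynomial.X * extendedX _ n i

/-- The polynomials `E_k - T E_{k-1} + T ^ 2 E_{k-2} - ⋯`. -/
noncomputable def alternating : ℕ → Polynomial (MvPolynomial (Fin (n + 1)) A)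
  | 0 => 1
  | k + 1 => Polynomial.C (extendedX A (n + 1) (k + 1)) - Polynomial.X * alternating k

/-- The recursion multiplies the leading term by `-T` at each step; the sign `(-1)^k` undoes this.
For `k = n + 1` this is the monic polynomial whose root is the adjoined variable. -/
theorem monic_alternating [Nontrivial A] (k : ℕ) :
    ((-1) ^ k * alternating A n k).Monic ∧ ((-1) ^ k * alternating A n k).natDegree = k := by
  induction k with
  | zero => simp [alternating]
  | succ k ih =>
    have h : (-1) ^ (k + 1) * alternating A n (k + 1) =
        Polynomial.X * ((-1) ^ k * alternating A n k) +
          Polynomial.C ((-1) ^ (k + 1) * extendedX A (n + 1) (k + 1)) := by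
      rw [alternating]
      simp only [map_mul, map_pow, map_neg, map_one]
      ring
    have hdeg : (Polynomial.X * ((-1) ^ k * alternating A n k)).natDegree = k + 1 := by
      rw [Polynomial.natDegree_X_mul ih.1.ne_zero, ih.2]
    rw [h]
    refine ⟨?_, ?_⟩
    · refine (Polynomial.monic_X.mul ih.1).add_of_left (lt_of_le_of_lt Polynomial.degree_C_le ?_)
      rw [← Polynomial.natDegree_pos_iff_degree_pos, hdeg]
      exact Nat.succ_pos k
    · rw [Polynomial.natDegree_add_C, hdeg]

/-- Write `E'_k` for the target variables. The relations `E_k = E'_k + T E'_{k-1}` with `k ≤ n` can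
be solved successively, `E'_k` being the value of `alternating` at `k`. The last relation, `E_{n+1}
= T E'_n`, says that `alternating` vanishes at `n + 1`. So the target arises from the source by
adjoining a root `T` of a monic polynomial, and is free over it. -/
theorem flat_adjoinVariable : (adjoinVariable A n).toRingHom.Flat := by
  rcases subsingleton_or_nontrivial A with hA | hA
  · have h1 := Module.subsingleton A (MvPolynomial (Fin (n + 1)) A)
    have h2 := Module.subsingleton A (MvPolynomial (Fin n) (Polynomial A))
    exact RingHom.Flat.of_bijective ⟨Function.injective_of_subsingleton _,
      Function.surjective_to_subsingleton _⟩
  set F := (-1) ^ (n + 1) * alternating A n (n + 1) with hF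
  have hmonic : F.Monic := (monic_alternating A n (n + 1)).1
  -- Evaluation at the actual `T` turns the alternating polynomial into `E'_k`. The index `n + 1` is
  -- included because `E'_{n+1} = 0` is the equation satisfied by `T`.
  have hα : ∀ k, k ≤ n + 1 → (alternating A n k).eval₂ (adjoinVariable A n).toRingHom
      (C Polynomial.X) = extendedX _ n k := by
    intro k
    induction k with
    | zero => intro _; simp [alternating, extendedX]
    | succ k ih =>
      intro hk
      rw [alternating, Polynomial.eval₂_sub, Polynomial.eval₂_mul, Polynomial.eval₂_C,
        Polynomial.eval₂_X, ih (by omega), extendedX_succ_of_lt (by omega : k < n + 1)]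
      simp [adjoinVariable]
  have hroot : F.eval₂ (adjoinVariable A n).toRingHom (C Polynomial.X) = 0 := by
    rw [hF, Polynomial.eval₂_mul, hα _ le_rfl, extendedX_succ_self, mul_zero]
  -- `e` and `g` are mutually inverse: `e` sends the root to `T`, and `g` sends `E'_k` to its
  -- expression through the `E_j` and the root.
  let e : AdjoinRoot F →+* MvPolynomial (Fin n) (Polynomial A) :=
    AdjoinRoot.lift (adjoinVariable A n).toRingHom (C Polynomial.X) hroot
  let g : MvPolynomial (Fin n) (Polynomial A) →+* AdjoinRoot F :=
    eval₂Hom (Polynomial.eval₂RingHom ((AdjoinRoot.of F).comp C) (AdjoinRoot.root F))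
      fun i => AdjoinRoot.mk F (alternating A n (i + 1))
  have hmk : ∀ k, AdjoinRoot.mk F (alternating A n (k + 1)) =
      AdjoinRoot.of F (extendedX A (n + 1) (k + 1)) -
        AdjoinRoot.root F * AdjoinRoot.mk F (alternating A n k) := by
    intro k
    rw [alternating, map_sub, map_mul, AdjoinRoot.mk_C, AdjoinRoot.mk_X]
  have hlast : AdjoinRoot.mk F (alternating A n (n + 1)) = 0 := by
    have h1 : AdjoinRoot.mk F F = 0 := AdjoinRoot.mk_self
    rw [hF, map_mul, map_pow, map_neg, map_one] at h1
    exact (((isUnit_one.neg).pow (n + 1)).mul_right_eq_zero).mp h1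
  have hg : ∀ k, k ≤ n + 1 → g (extendedX _ n k) = AdjoinRoot.mk F (alternating A n k) := by
    intro k hk
    rcases k with _ | k
    · simp [extendedX, alternating]
    · rcases Nat.lt_or_ge k n with h | h
      · rw [extendedX_succ_of_lt h]
        simp [g]
      · obtain rfl : k = n := by omega
        rw [extendedX_succ_self, map_zero, hlast]
  have he : ∀ P, e (AdjoinRoot.of F P) = adjoinVariable A n P := fun P => by simp [e]
  have h1 : g.comp e = RingHom.id _ := by
    refine AdjoinRoot.ringHom_ext ?_ ?_
    · refine MvPolynomial.ringHom_ext ?_ ?_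
      · intro a
        simp [e, g, adjoinVariable]
      · intro i
        have hi : extendedX A (n + 1) (i + 1) = X i := extendedX_succ_of_lt i.2
        simp only [RingHom.comp_apply, RingHom.id_apply, he]
        rw [adjoinVariable, aeval_X, map_add, map_mul, hg _ (by omega), hg _ (by omega), hmk, hi]
        simp [g]
    · simp [e, g]
  have h2 : e.comp g = RingHom.id _ := by
    refine MvPolynomial.ringHom_ext ?_ ?_
    · intro p
      have : (e.comp g).comp C = (C : Polynomial A →+* MvPolynomial (Fin n) (Polynomial A)) := by
        refine Polynomial.ringHom_ext ?_ ?_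
        · intro a
          simp [e, g, adjoinVariable]
        · simp [e, g]
      exact DFunLike.congr_fun this p
    · intro i
      have hi : extendedX (Polynomial A) n (i + 1) = X i := extendedX_succ_of_lt i.2
      rw [← hi, RingHom.comp_apply, hg _ (by omega), RingHom.id_apply]
      change (AdjoinRoot.lift _ _ _) (AdjoinRoot.mk F _) = _
      rw [AdjoinRoot.lift_mk, hα _ (by omega)]
  have hflat : (AdjoinRoot.of F).Flat := by
    have := hmonic.free_adjoinRoot
    exact RingHom.flat_algebraMap_iff.mpr (inferInstance : Module.Flat _ (AdjoinRoot F))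
  have hcomp : (adjoinVariable A n).toRingHom = e.comp (AdjoinRoot.of F) :=
    RingHom.ext fun P => (he P).symm
  rw [hcomp]
  refine hflat.comp (RingHom.Flat.of_bijective ⟨?_, ?_⟩)
  · exact Function.LeftInverse.injective (g := g) fun x => DFunLike.congr_fun h1 x
  · exact Function.RightInverse.surjective (g := g) fun x => DFunLike.congr_fun h2 x

end Step

theorem _root_.Multiset.esymm_cons {A : Type*} [CommSemiring A] (a : A) (s : Multiset A) (k : ℕ) :
    (a ::ₘ s).esymm (k + 1) = s.esymm (k + 1) + a * s.esymm k := by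
  simp [Multiset.esymm, Multiset.powersetCard_cons, Multiset.map_map, Multiset.sum_map_mul_left]

theorem esymm_option {A : Type*} [CommRing A] (σ : Type*) [Fintype σ] (k : ℕ) :
    esymm (Option σ) A (k + 1) =
      rename some (esymm σ A (k + 1)) + X none * rename some (esymm σ A k) := by
  have h : ∀ k, rename (R := A) (some : σ → Option σ) (esymm σ A k) =
      ((Finset.univ.val.map (some : σ → Option σ)).map X).esymm k := by
    intro k
    have h0 : rename (R := A) (some : σ → Option σ) = aeval (X ∘ some) := by
      ext
      simp
    rw [h0, aeval_esymm_eq_multiset_esymm, Multiset.map_map]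
  rw [h, h, esymm_eq_multiset_esymm, ← Multiset.esymm_cons, ← Multiset.map_cons]
  rfl

/-- The polynomial ring is flat over the elementary symmetric polynomials. -/
theorem flat_aeval_esymm (A : Type*) [CommRing A] (n : ℕ) :
    (aeval (fun i : Fin n => esymm (Fin n) A (i + 1)) :
      MvPolynomial (Fin n) A →ₐ[A] MvPolynomial (Fin n) A).toRingHom.Flat := by
  induction n generalizing A with
  | zero =>
    have : (aeval (fun i : Fin 0 => esymm (Fin 0) A (i + 1)) :
      MvPolynomial (Fin 0) A →ₐ[A] MvPolynomial (Fin 0) A) = AlgHom.id A _ := by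
      ext i
      exact i.elim0
    rw [this]
    exact RingHom.Flat.id _
  | succ n ih =>
    let r : MvPolynomial (Option (Fin n)) A ≃ₐ[A] MvPolynomial (Fin (n + 1)) A :=
      renameEquiv A (_root_.finSuccEquiv n).symm
    have hr : ∀ k, r (esymm _ A k) = esymm _ A k := fun k => rename_esymm _ _ _ _
    have hopt : ∀ k, (optionEquivRight A (Fin n)) (rename some (esymm (Fin n) A k)) =
        esymm (Fin n) (Polynomial A) k := by
      intro k
      rw [optionEquivRight_apply, aeval_rename, aeval_esymm_eq_multiset_esymm,
        esymm_eq_multiset_esymm]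
      rfl
    -- Single out one variable `T` and factor the map: first express each `E_k` through `T` and the
    -- `E'_j`, then substitute the elementary symmetric polynomials of the other `n` variables. The
    -- second factor is the induction hypothesis over `A[T]`, which is why `A` varies in the
    -- induction.
    have key : (aeval (fun i : Fin (n + 1) => esymm (Fin (n + 1)) A (i + 1)) :
        MvPolynomial (Fin (n + 1)) A →ₐ[A] _).toRingHom =
        (((optionEquivRight A (Fin n)).symm.trans r).toAlgHom.toRingHom.comp
        ((aeval (fun i : Fin n => esymm (Fin n) (Polynomial A) (i + 1)) :
          MvPolynomial (Fin n) (Polynomial A) →ₐ[Polynomial A] _).toRingHom)).comp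
          (adjoinVariable A n).toRingHom := by
      have hext : ∀ k, k ≤ n + 1 → (aeval (fun i : Fin n => esymm (Fin n) (Polynomial A) (i + 1)) :
          MvPolynomial (Fin n) (Polynomial A) →ₐ[Polynomial A] _) (extendedX _ n k) =
            esymm (Fin n) (Polynomial A) k := by
        intro k hk
        rcases k with _ | k
        · simp [extendedX]
        · rcases Nat.lt_or_ge k n with h | h
          · rw [extendedX_succ_of_lt h, aeval_X]
          · obtain rfl : k = n := by omega
            rw [extendedX_succ_self, map_zero, esymm, Finset.powersetCard_eq_empty.mpr (by simp),
              Finset.sum_empty]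
      refine MvPolynomial.ringHom_ext ?_ ?_
      · intro a
        have h1 : (C (Polynomial.C a) : MvPolynomial (Fin n) (Polynomial A)) =
            algebraMap A _ a := rfl
        simp only [AlgHom.toRingHom_eq_coe, RingHom.comp_apply, RingHom.coe_coe, algHom_C]
        have h2 : ∀ p : Polynomial A, algebraMap (Polynomial A)
          (MvPolynomial (Fin n) (Polynomial A)) p = C p := fun _ => rfl
        rw [← h1, algHom_C, h2, h1, AlgHom.commutes]
      · intro i
        simp only [AlgHom.toRingHom_eq_coe, RingHom.comp_apply, RingHom.coe_coe, aeval_X,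
          adjoinVariable, map_add, map_mul, hext _ (by omega : (i : ℕ) + 1 ≤ n + 1),
          hext _ (by omega : (i : ℕ) ≤ n + 1)]
        rw [← hr, esymm_option, ← hopt, ← hopt, algHom_C, algebraMap_eq, ← optionEquivRight_X_none]
        simp only [AlgEquiv.toAlgHom_apply, AlgEquiv.trans_apply, AlgEquiv.symm_apply_apply,
          map_add, map_mul]
    rw [key]
    exact (flat_adjoinVariable A n).comp
      ((ih (Polynomial A)).comp (RingHom.Flat.of_bijective (AlgEquiv.bijective _)))

/-- `T[σ]` is the base change of `T` along `S → S[σ]`, and flatness is stable under base change. -/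
theorem flat_map {S T : Type*} [CommRing S] [CommRing T] (f : S →+* T) (hf : f.Flat)
    (σ : Type*) : (map (σ := σ) f).Flat := by
  algebraize [f]
  let := MvPolynomial.algebraMvPolynomial (R := S) (S := T) (σ := σ)
  have h : Module.Flat (MvPolynomial σ S) (MvPolynomial σ T) :=
    Module.Flat.isBaseChange S (MvPolynomial σ S) T (MvPolynomial σ T)
      (Algebra.IsPushout.out (R := S) (S := MvPolynomial σ S) (R' := T))
  exact RingHom.flat_algebraMap_iff.mpr h

/-- The elementary symmetric polynomials in the first set of variables, followed by those in the
second set. -/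
noncomputable def esymmSum (A : Type*) [CommRing A] (n : ℕ) :
    Fin n ⊕ Fin n → MvPolynomial (Fin n ⊕ Fin n) A :=
  Sum.elim (fun i => rename Sum.inl (esymm (Fin n) A (i + 1)))
    (fun i => rename Sum.inr (esymm (Fin n) A (i + 1)))

/-- The polynomial ring in two sets of variables is flat over the elementary symmetric polynomials
in each of the two sets. -/
theorem flat_aeval_esymm_sum (A : Type*) [CommRing A] (n : ℕ) :
    (aeval (R := A) (esymmSum A n)).toRingHom.Flat := by
  set ψ : MvPolynomial (Fin n) A →ₐ[A] MvPolynomial (Fin n) A :=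
    aeval (fun i : Fin n => esymm (Fin n) A (i + 1)) with hψ
  have hψf : ψ.toRingHom.Flat := flat_aeval_esymm A n
  have h1 : (map (σ := Fin n) ψ.toRingHom).Flat := flat_map _ hψf _
  -- Regard `A[x, y]` as `A[y][x]`: substitute in the `y`-variables on coefficients, then in the
  -- `x`-variables over the base `A[y]`.
  have key : (aeval (R := A) (esymmSum A n)).toRingHom =
      (((sumAlgEquiv A (Fin n) (Fin n)).symm.toAlgHom.toRingHom.comp
        (aeval (fun i : Fin n => esymm (Fin n) (MvPolynomial (Fin n) A) (i + 1)) :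
          MvPolynomial (Fin n) (MvPolynomial (Fin n) A) →ₐ[MvPolynomial (Fin n) A] _).toRingHom).comp
        (map (σ := Fin n) ψ.toRingHom)).comp (sumAlgEquiv A (Fin n) (Fin n)).toAlgHom.toRingHom := by
    have hl : ∀ k, sumAlgEquiv A (Fin n) (Fin n) (rename Sum.inl (esymm (Fin n) A k)) =
        esymm (Fin n) (MvPolynomial (Fin n) A) k := by
      intro k
      have h2 := DFunLike.congr_fun (sumAlgEquiv_comp_rename_inl A (Fin n) (Fin n))
        (esymm (Fin n) A k)
      exact h2.trans (map_esymm _ _ _ _)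
    have hr : ∀ P, sumAlgEquiv A (Fin n) (Fin n) (rename Sum.inr P) = C P := fun P =>
      DFunLike.congr_fun (sumAlgEquiv_comp_rename_inr A (Fin n) (Fin n)) P
    refine MvPolynomial.ringHom_ext ?_ ?_
    · intro a
      simp
    · rintro (i | i)
      · simp only [AlgHom.toRingHom_eq_coe, RingHom.comp_apply, RingHom.coe_coe, aeval_X,
          esymmSum, Sum.elim_inl, AlgEquiv.toAlgHom_apply, sumAlgEquiv_X_inl, map_X]
        rw [← hl, AlgEquiv.symm_apply_apply]
      · simp only [AlgHom.toRingHom_eq_coe, RingHom.comp_apply, RingHom.coe_coe, aeval_X,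
          esymmSum, Sum.elim_inr, AlgEquiv.toAlgHom_apply, sumAlgEquiv_X_inr, map_C, algHom_C,
          algebraMap_eq]
        rw [hψ, aeval_X, ← hr, AlgEquiv.symm_apply_apply]
  rw [key]
  exact (RingHom.Flat.of_bijective (AlgEquiv.bijective _)).comp
    (h1.comp ((flat_aeval_esymm _ n).comp (RingHom.Flat.of_bijective (AlgEquiv.bijective _))))

/-- Membership in an ideal generated by variables is tested on monomials, and multiplying a monomial
by `X v` does not change its divisibility by any other variable. -/
theorem mem_span_X_image_of_mul_mem {A σ : Type*} [CommRing A] {s : Set σ} {v : σ} (hv : v ∉ s)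
    {P : MvPolynomial σ A} (hP : X v * P ∈ Ideal.span (X '' s : Set (MvPolynomial σ A))) :
    P ∈ Ideal.span (X '' s : Set (MvPolynomial σ A)) := by
  rw [mem_ideal_span_X_image] at hP ⊢
  intro m hm
  obtain ⟨i, hi, h⟩ := hP (Finsupp.single v 1 + m) (by
    rw [mem_support_iff] at hm ⊢
    rwa [coeff_X_mul])
  refine ⟨i, hi, ?_⟩
  have hvi : v ≠ i := fun h => hv (h ▸ hi)
  simpa [Finsupp.single_apply, hvi] using h

/-- The elementary symmetric polynomials in two sets of variables form a regular sequence, in any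
order. -/
theorem mem_span_esymmSum_of_mul_mem {A : Type*} [CommRing A] {n : ℕ} {s : Set (Fin n ⊕ Fin n)}
    {v : Fin n ⊕ Fin n} (hv : v ∉ s) {P : MvPolynomial (Fin n ⊕ Fin n) A}
    (hP : esymmSum A n v * P ∈ Ideal.span (esymmSum A n '' s)) :
    P ∈ Ideal.span (esymmSum A n '' s) := by
  -- The ideal is the extension, along the flat map, of one generated by variables, so regularity is
  -- inherited from there.
  have hmap : (Ideal.span (X '' s : Set (MvPolynomial (Fin n ⊕ Fin n) A))).map
      (aeval (esymmSum A n)).toRingHom = Ideal.span (esymmSum A n '' s) := by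
    rw [Ideal.map_span, Set.image_image]
    simp
  rw [← hmap] at hP ⊢
  refine (flat_aeval_esymm_sum A n).mem_map_of_mul_mem_map _ (X v)
    (fun x hx => mem_span_X_image_of_mul_mem hv hx) ?_
  have hX : (aeval (R := A) (esymmSum A n)).toRingHom (X v) = esymmSum A n v := aeval_X _ _
  change (aeval (R := A) (esymmSum A n)).toRingHom (X v) * P ∈ _
  rwa [hX]

theorem constantCoeff_esymm_succ (A : Type*) [CommRing A] (σ : Type*) [Fintype σ] (k : ℕ) :
    constantCoeff (esymm σ A (k + 1)) = 0 := by
  rw [esymm, map_sum]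
  refine Finset.sum_eq_zero fun s hs => ?_
  rw [map_prod]
  obtain ⟨i, hi⟩ := Finset.card_pos.mp (by rw [(Finset.mem_powersetCard.mp hs).2]; omega)
  exact Finset.prod_eq_zero hi (constantCoeff_X A i)

/-- By the fundamental theorem `P = Q(e_1, …, e_n)`. Since the `e_i` have no constant term, `Q` has
the same constant term as `P`, namely zero, so `Q` lies in the ideal of the variables. -/
theorem IsSymmetric.mem_span_esymm {A : Type*} [CommRing A] {n : ℕ} {P : MvPolynomial (Fin n) A}
    (hP : P.IsSymmetric) (h0 : constantCoeff P = 0) :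
    P ∈ Ideal.span (Set.range fun i : Fin n => esymm (Fin n) A (i + 1)) := by
  obtain ⟨Q, hQ⟩ := (esymmAlgHom_fin_bijective A n).2 ⟨P, hP⟩
  have hQ' : aeval (fun i : Fin n => esymm (Fin n) A (i + 1)) Q = P := by
    rw [← esymmAlgHom_apply, hQ]
  have hQ0 : constantCoeff Q = 0 := by
    have h1 : ((constantCoeff (σ := Fin n) (R := A)).comp
        (aeval (fun i : Fin n => esymm (Fin n) A (i + 1))).toRingHom) = constantCoeff := by
      refine ringHom_ext (fun a => ?_) fun i => ?_
      · simp
      · simp [constantCoeff_esymm_succ]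
    rw [← h0, ← hQ']
    exact (DFunLike.congr_fun h1 Q).symm
  have hmem : Q ∈ Ideal.span (X '' (Set.univ : Set (Fin n)) : Set (MvPolynomial (Fin n) A)) := by
    rw [mem_ideal_span_X_image]
    intro m hm
    by_contra! h
    have : m = 0 := by
      ext i
      exact h i (Set.mem_univ i)
    rw [mem_support_iff, this] at hm
    exact hm hQ0
  have h2 := Ideal.mem_map_of_mem (aeval (fun i : Fin n => esymm (Fin n) A (i + 1))).toRingHom hmem
  rw [Ideal.map_span, Set.image_univ, ← Set.range_comp] at h2
  convert h2 using 2
  · ext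
    simp
  · exact hQ'.symm

theorem isSymmetric_sum_rename {A : Type*} [CommRing A] {σ : Type*} [Fintype σ] [DecidableEq σ]
    (P : MvPolynomial σ A) : (∑ g : Equiv.Perm σ, rename g P).IsSymmetric := by
  intro e
  rw [map_sum]
  refine Fintype.sum_equiv (Equiv.mulLeft e) _ _ fun g => ?_
  rw [rename_rename]
  rfl

end MvPolynomial

/-! ### Generators of the invariant ideal -/

namespace BigradedFrobenius

open MvPolynomial

/-- For the monomial `x^a y^b` the sum over `S_n × S_n` is the symmetrization of `x^a` times that of
`y^b`. As `a` or `b` is nonzero, one factor is symmetric without constant term. -/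
theorem sum_action_mem_span (n : ℕ) {m : (Fin n ⊕ Fin n) →₀ ℕ} (hm : m ≠ 0) :
    ∑ g, action n g (monomial m 1) ∈ Ideal.span (Set.range (esymmSum ℂ n)) := by
  classical
  obtain ⟨⟨a, b⟩, rfl⟩ := Finsupp.sumFinsuppAddEquivProdFinsupp (M := ℕ).symm.surjective m
  have hab : (monomial (Finsupp.sumFinsuppAddEquivProdFinsupp.symm (a, b)) (1 : ℂ) :
      R n) = rename Sum.inl (monomial a 1) * rename Sum.inr (monomial b 1) := by
    rw [rename_monomial, rename_monomial, monomial_mul, one_mul]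
    refine congrArg (fun d => monomial d (1 : ℂ)) (Finsupp.ext ?_)
    rintro (i | i)
    · simp [Finsupp.mapDomain_apply Sum.inl_injective, Finsupp.mapDomain_of_notMem_range]
    · simp [Finsupp.mapDomain_apply Sum.inr_injective, Finsupp.mapDomain_of_notMem_range]
  have hsum : ∑ g, action n g (monomial (Finsupp.sumFinsuppAddEquivProdFinsupp.symm (a, b)) 1) =
      rename Sum.inl (∑ σ : Equiv.Perm (Fin n), rename σ (monomial a 1)) *
        rename Sum.inr (∑ τ : Equiv.Perm (Fin n), rename τ (monomial b 1)) := by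
    rw [map_sum, map_sum, Finset.sum_mul_sum, ← Finset.sum_product']
    refine Finset.sum_congr rfl fun g _ => ?_
    rw [hab]
    change rename (Sum.map g.1 g.2) _ = _
    rw [map_mul, rename_rename, rename_rename, rename_rename, rename_rename]
    rfl
  have hc : ∀ c : Fin n →₀ ℕ, c ≠ 0 → (∑ σ : Equiv.Perm (Fin n), rename σ (monomial c (1 : ℂ))) ∈
      Ideal.span (Set.range fun i : Fin n => esymm (Fin n) ℂ (i + 1)) := by
    intro c hc
    refine (isSymmetric_sum_rename _).mem_span_esymm ?_
    rw [map_sum]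
    refine Finset.sum_eq_zero fun σ _ => ?_
    rw [constantCoeff_rename, constantCoeff_monomial, if_neg hc]
  have hmap : ∀ (f : Fin n → Fin n ⊕ Fin n), (∀ i : Fin n, rename f (esymm (Fin n) ℂ (i + 1)) ∈
      Set.range (esymmSum ℂ n)) → ∀ P ∈ Ideal.span (Set.range fun i : Fin n =>
        esymm (Fin n) ℂ (i + 1)), rename f P ∈ Ideal.span (Set.range (esymmSum ℂ n)) := by
    intro f hf P hP
    have : Ideal.span (Set.range fun i : Fin n => esymm (Fin n) ℂ (i + 1)) ≤
        (Ideal.span (Set.range (esymmSum ℂ n))).comap (rename (R := ℂ) f).toRingHom := by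
      refine Ideal.span_le.mpr ?_
      rintro _ ⟨i, rfl⟩
      exact Ideal.subset_span (hf i)
    exact this hP
  rw [hsum]
  by_cases ha : a = 0
  · refine Ideal.mul_mem_left _ _ (hmap _ (fun i => ⟨Sum.inr i, rfl⟩) _ (hc b ?_))
    rintro rfl
    exact hm (by rw [ha]; exact map_zero _)
  · exact Ideal.mul_mem_right _ _ (hmap _ (fun i => ⟨Sum.inl i, rfl⟩) _ (hc a ha))

/-- Averaging over the group: an invariant polynomial, times the group order, is a combination of
the symmetrizations of its monomials, and none of these is the constant monomial. -/
theorem invariantIdeal_eq (n : ℕ) :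
    invariantIdeal n = Ideal.span (Set.range (esymmSum ℂ n)) := by
  refine le_antisymm (Ideal.span_le.mpr ?_) (Ideal.span_mono ?_)
  · rintro P ⟨hP, h0⟩
    have h1 : (Fintype.card (Equiv.Perm (Fin n) × Equiv.Perm (Fin n)) : ℂ) • P =
        ∑ m ∈ P.support, P.coeff m • ∑ g, action n g (monomial m 1) := by
      simp only [Finset.smul_sum, ← map_smul]
      rw [Finset.sum_comm]
      simp only [← map_sum, smul_eq_mul, mul_one, support_sum_monomial_coeff, hP]
      rw [Finset.sum_const, Finset.card_univ, Nat.cast_smul_eq_nsmul]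
    have h2 : (Fintype.card (Equiv.Perm (Fin n) × Equiv.Perm (Fin n)) : ℂ) • P ∈
        (Ideal.span (Set.range (esymmSum ℂ n))).restrictScalars ℂ := by
      rw [h1]
      refine Submodule.sum_mem _ fun m hm => Submodule.smul_mem _ _ (sum_action_mem_span n ?_)
      rintro rfl
      exact (mem_support_iff.mp hm) h0
    exact ((Submodule.smul_mem_iff _ (by exact_mod_cast Fintype.card_ne_zero)).mp h2)
  · rintro _ ⟨i | i, rfl⟩
    · refine ⟨fun g => ?_, ?_⟩
      · change rename (Sum.map g.1 g.2) (rename Sum.inl _) = rename Sum.inl _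
        rw [rename_rename, show Sum.map g.1 g.2 ∘ Sum.inl = Sum.inl ∘ g.1 from rfl, ← rename_rename,
          esymm_isSymmetric]
      · exact (constantCoeff_rename _ _).trans (constantCoeff_esymm_succ _ _ _)
    · refine ⟨fun g => ?_, ?_⟩
      · change rename (Sum.map g.1 g.2) (rename Sum.inr _) = rename Sum.inr _
        rw [rename_rename, show Sum.map g.1 g.2 ∘ Sum.inr = Sum.inr ∘ g.2 from rfl, ← rename_rename,
          esymm_isSymmetric]
      · exact (constantCoeff_rename _ _).trans (constantCoeff_esymm_succ _ _ _)

end BigradedFrobenius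

/-! ### Traces in exact sequences and on invariant subspaces -/

namespace LinearMap

variable {K : Type*} [Field K]

/-- The trace is additive in short exact sequences. -/
theorem trace_eq_add_of_exact {A B C : Type*} [AddCommGroup A] [Module K A] [AddCommGroup B]
    [Module K B] [AddCommGroup C] [Module K C] [FiniteDimensional K B] {f : A →ₗ[K] B}
    {g : B →ₗ[K] C} (hf : Function.Injective f) (hg : Function.Surjective g)
    (hfg : LinearMap.range f = LinearMap.ker g) {a : A →ₗ[K] A} {b : B →ₗ[K] B} {c : C →ₗ[K] C}
    (hab : b ∘ₗ f = f ∘ₗ a) (hbc : g ∘ₗ b = c ∘ₗ g) :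
    trace K B b = trace K A a + trace K C c := by
  have : FiniteDimensional K A := FiniteDimensional.of_injective f hf
  have : FiniteDimensional K C := Module.Finite.of_surjective g hg
  obtain ⟨s, hs⟩ := g.exists_rightInverse_of_surjective (LinearMap.range_eq_top.mpr hg)
  have hmem : ∀ x, x - s (g x) ∈ LinearMap.range f := by
    intro x
    rw [hfg, LinearMap.mem_ker, map_sub, ← LinearMap.comp_apply g s, hs, LinearMap.id_apply,
      sub_self]
  -- The retraction of `f` attached to the section `s`, so that `f r + s g = 1`. Then `b = f a r + b
  -- s g`, and cyclicity of the trace turns the summands into the traces of `a` and `c`.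
  let r : B →ₗ[K] A := (LinearEquiv.ofInjective f hf).symm.toLinearMap ∘ₗ
    (LinearMap.id - s ∘ₗ g).codRestrict (LinearMap.range f) hmem
  have hr : ∀ x, f (r x) = x - s (g x) := fun x =>
    congrArg Subtype.val ((LinearEquiv.ofInjective f hf).apply_symm_apply ⟨x - s (g x), hmem x⟩)
  have hgf : ∀ x, g (f x) = 0 := fun x => by
    rw [← LinearMap.mem_ker, ← hfg]
    exact ⟨x, rfl⟩
  have hrf : r ∘ₗ f = LinearMap.id := by
    refine LinearMap.ext fun x => hf ?_
    rw [LinearMap.comp_apply, hr, hgf, map_zero, sub_zero, LinearMap.id_apply]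
  have hb : b = (f ∘ₗ a) ∘ₗ r + b ∘ₗ s ∘ₗ g := by
    refine LinearMap.ext fun x => ?_
    rw [← hab]
    simp only [LinearMap.add_apply, LinearMap.comp_apply, hr, map_sub, sub_add_cancel]
  conv_lhs => rw [hb]
  rw [map_add, trace_comp_comm' r (f ∘ₗ a), ← LinearMap.comp_assoc, hrf, LinearMap.id_comp,
    ← LinearMap.comp_assoc, trace_comp_comm' g (b ∘ₗ s), ← LinearMap.comp_assoc,
    hbc, LinearMap.comp_assoc, hs, LinearMap.comp_id]

open Classical in
/-- The trace of an endomorphism on an invariant subspace (and `0` if the subspace is not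
invariant). -/
noncomputable def traceOn {W : Type*} [AddCommGroup W] [Module K W] (g : Module.End K W)
    (V : Submodule K W) : K :=
  if h : ∀ x ∈ V, g x ∈ V then trace K V (g.restrict h) else 0

theorem traceOn_eq {W : Type*} [AddCommGroup W] [Module K W] {g : Module.End K W}
    {V : Submodule K W} (h : ∀ x ∈ V, g x ∈ V) : traceOn g V = trace K V (g.restrict h) :=
  dif_pos h

end LinearMap

/-! ### Graded traces on quotients by homogeneous ideals -/

namespace MvPolynomial

open LinearMap

variable {K : Type*} [Field K] {σ τ : Type*} {w : σ → τ →₀ ℕ}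

theorem weightedHomogeneousComponent_mul_of_left_mem {e : τ →₀ ℕ} {f : MvPolynomial σ K}
    (hf : IsWeightedHomogeneous w f e) (d : τ →₀ ℕ) (r : MvPolynomial σ K) :
    weightedHomogeneousComponent w (e + d) (f * r) = f * weightedHomogeneousComponent w d r := by
  classical
  let := weightedGradedAlgebra K w
  have h := DirectSum.coe_decompose_mul_of_left_mem_of_le (weightedHomogeneousSubmodule K w)
    (b := r) ((mem_weightedHomogeneousSubmodule K w e f).mpr hf) (le_self_add : e ≤ e + d)
  rw [add_tsub_cancel_left] at h
  have h2 : ∀ P d, (DirectSum.decompose (weightedHomogeneousSubmodule K w) P d : MvPolynomial σ K)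
      = weightedHomogeneousComponent w d P :=
    fun P d => weightedDecomposition.decompose'_apply K w P d
  rwa [h2, h2] at h

theorem weightedHomogeneousComponent_mul_of_not_le {e d : τ →₀ ℕ} {f : MvPolynomial σ K}
    (hf : IsWeightedHomogeneous w f e) (h : ¬ e ≤ d) (r : MvPolynomial σ K) :
    weightedHomogeneousComponent w d (f * r) = 0 := by
  classical
  let := weightedGradedAlgebra K w
  have h := DirectSum.coe_decompose_mul_of_left_mem_of_not_le (weightedHomogeneousSubmodule K w)
    (b := r) ((mem_weightedHomogeneousSubmodule K w e f).mpr hf) h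
  have h2 : ∀ P d, (DirectSum.decompose (weightedHomogeneousSubmodule K w) P d : MvPolynomial σ K)
      = weightedHomogeneousComponent w d P :=
    fun P d => weightedDecomposition.decompose'_apply K w P d
  rwa [h2] at h

theorem weightedHomogeneousComponent_mem_span {S : Set (MvPolynomial σ K)}
    (hS : ∀ f ∈ S, ∃ e, IsWeightedHomogeneous w f e) {P : MvPolynomial σ K}
    (hP : P ∈ Ideal.span S) (d : τ →₀ ℕ) : weightedHomogeneousComponent w d P ∈ Ideal.span S := by
  classical
  let := weightedGradedAlgebra K w
  refine weightedHomogeneousComponent_mem_of_mem K w (Ideal.homogeneous_span _ _ ?_) hP d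
  intro f hf
  obtain ⟨e, he⟩ := hS f hf
  exact ⟨e, he⟩

variable (w) in
/-- The component of degree `d` of an ideal. -/
noncomputable def idealComponent (I : Ideal (MvPolynomial σ K)) (d : τ →₀ ℕ) :
    Submodule K (MvPolynomial σ K) :=
  I.restrictScalars K ⊓ weightedHomogeneousSubmodule K w d

variable (w) in
/-- The generating function of the traces of `g` on the graded components of the quotient by the
ideal `I`. -/
noncomputable def quotientTraceSeries (g : Module.End K (MvPolynomial σ K))
    (I : Ideal (MvPolynomial σ K)) : MvPowerSeries τ K :=
  fun d => traceOn g (weightedHomogeneousSubmodule K w d) - traceOn g (idealComponent w I d)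

theorem finiteDimensional_weightedHomogeneousSubmodule {d : τ →₀ ℕ}
    (h : {m : σ →₀ ℕ | Finsupp.weight w m = d}.Finite) :
    FiniteDimensional K (weightedHomogeneousSubmodule K w d) := by
  have := h.to_subtype
  let f : weightedHomogeneousSubmodule K w d →ₗ[K] {m : σ →₀ ℕ | Finsupp.weight w m = d} → K :=
    LinearMap.pi fun m => lcoeff K m.1 ∘ₗ Submodule.subtype _
  refine FiniteDimensional.of_injective f ?_
  rw [injective_iff_map_eq_zero]
  rintro ⟨P, hP⟩ h0
  ext m
  by_cases hm : Finsupp.weight w m = d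
  · exact congrFun h0 ⟨m, hm⟩
  · exact hP.coeff_eq_zero m hm

variable {g : Module.End K (MvPolynomial σ K)}
  {I : Ideal (MvPolynomial σ K)} {f : MvPolynomial σ K} {e : τ →₀ ℕ}

/-- The sequence `0 → I_d → I_{e+d} ⊕ R_d → (I + (f))_{e+d} → 0` with maps `x ↦ (-f x, x)` and `(u,
r) ↦ u + f r` is exact and compatible with `g`. Regularity of `f` modulo `I` gives exactness in the
middle; homogeneity of `I` and `f` gives surjectivity. -/
theorem traceOn_idealComponent_sup (hfin : ∀ d, {m : σ →₀ ℕ | Finsupp.weight w m = d}.Finite)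
    (hg : ∀ d P, IsWeightedHomogeneous w P d → IsWeightedHomogeneous w (g P) d)
    (hgf : ∀ P, g (f * P) = f * g P) (hgI : ∀ P ∈ I, g P ∈ I)
    (hI : ∀ P ∈ I, ∀ d, weightedHomogeneousComponent w d P ∈ I)
    (hf : IsWeightedHomogeneous w f e) (hreg : ∀ P, f * P ∈ I → P ∈ I) (d : τ →₀ ℕ) :
    traceOn g (idealComponent w (I ⊔ Ideal.span {f}) (e + d)) + traceOn g (idealComponent w I d) =
      traceOn g (idealComponent w I (e + d)) +
        traceOn g (weightedHomogeneousSubmodule K w d) := by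
  have hfd := fun d => finiteDimensional_weightedHomogeneousSubmodule (K := K) (hfin d)
  have hfd' : ∀ (I : Ideal (MvPolynomial σ K)) d, FiniteDimensional K (idealComponent w I d) :=
    fun I d => Submodule.finiteDimensional_of_le inf_le_right
  have hgI' : ∀ P ∈ I ⊔ Ideal.span {f}, g P ∈ I ⊔ Ideal.span {f} := by
    intro P hP
    obtain ⟨a, ha, b, hb, rfl⟩ := Submodule.mem_sup.mp hP
    obtain ⟨r, rfl⟩ := Ideal.mem_span_singleton.mp hb
    rw [map_add, hgf]
    exact Submodule.add_mem_sup (hgI a ha) (Ideal.mem_span_singleton.mpr ⟨_, rfl⟩)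
  have hle : idealComponent w I (e + d) ≤ idealComponent w (I ⊔ Ideal.span {f}) (e + d) :=
    fun P hP => ⟨Submodule.mem_sup_left hP.1, hP.2⟩
  have hle' : idealComponent w I d ≤ weightedHomogeneousSubmodule K w d := fun P hP => hP.2
  have hA : ∀ d, ∀ P ∈ idealComponent w I d, g P ∈ idealComponent w I d :=
    fun d P hP => ⟨hgI P hP.1, hg d P hP.2⟩
  have hB : ∀ P ∈ weightedHomogeneousSubmodule K w d, g P ∈ weightedHomogeneousSubmodule K w d :=
    hg d
  have hC : ∀ P ∈ idealComponent w (I ⊔ Ideal.span {f}) (e + d),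
      g P ∈ idealComponent w (I ⊔ Ideal.span {f}) (e + d) :=
    fun P hP => ⟨hgI' P hP.1, hg _ P hP.2⟩
  rw [traceOn_eq (hA d), traceOn_eq (hA (e + d)), traceOn_eq hB, traceOn_eq hC]
  refine (add_comm _ _).trans (Eq.trans (Eq.symm ?_) (LinearMap.trace_prodMap' _ _))
  obtain ⟨i, hi1, hi2⟩ : ∃ i : idealComponent w I d →ₗ[K]
      idealComponent w I (e + d) × weightedHomogeneousSubmodule K w d,
      (∀ x, ((i x).1 : MvPolynomial σ K) = -(f * x)) ∧ ∀ x, ((i x).2 : MvPolynomial σ K) = x :=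
    ⟨(((LinearMap.mulLeft K (-f)).restrict (p := idealComponent w I d)
      (q := idealComponent w I (e + d)) fun P hP =>
        ⟨I.mul_mem_left _ hP.1, hf.neg.mul hP.2⟩)).prod (Submodule.inclusion hle'),
      fun x => neg_mul _ _, fun x => rfl⟩
  obtain ⟨p, hp⟩ : ∃ p : idealComponent w I (e + d) × weightedHomogeneousSubmodule K w d →ₗ[K]
      idealComponent w (I ⊔ Ideal.span {f}) (e + d),
      ∀ x, (p x : MvPolynomial σ K) = x.1 + f * x.2 :=
    ⟨(Submodule.inclusion hle).coprod
      ((LinearMap.mulLeft K f).restrict (p := weightedHomogeneousSubmodule K w d)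
      (q := idealComponent w (I ⊔ Ideal.span {f}) (e + d)) fun P hP =>
        ⟨Ideal.mul_mem_right _ _ (Submodule.mem_sup_right (Ideal.mem_span_singleton_self f)),
          hf.mul hP⟩), fun x => rfl⟩
  refine trace_eq_add_of_exact (f := i) (g := p) ?_ ?_ ?_ ?_ ?_
  · intro x y hxy
    refine Subtype.ext ?_
    rw [← hi2, ← hi2, hxy]
  · rintro ⟨P, hP, hPd⟩
    obtain ⟨a, ha, b, hb, rfl⟩ := Submodule.mem_sup.mp hP
    obtain ⟨r, rfl⟩ := Ideal.mem_span_singleton.mp hb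
    refine ⟨(⟨weightedHomogeneousComponent w (e + d) a, hI a ha _,
      weightedHomogeneousComponent_isWeightedHomogeneous _ _⟩,
      ⟨weightedHomogeneousComponent w d r,
        weightedHomogeneousComponent_isWeightedHomogeneous _ _⟩), Subtype.ext ?_⟩
    rw [hp]
    change _ + f * _ = a + f * r
    rw [← weightedHomogeneousComponent_mul_of_left_mem hf, ← map_add]
    exact IsWeightedHomogeneous.weightedHomogeneousComponent_same hPd
  · ext ⟨u, r⟩
    rw [LinearMap.mem_ker, LinearMap.mem_range]
    constructor
    · rintro ⟨x, hx⟩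
      refine Subtype.ext ?_
      rw [hp, ← hx, hi1, hi2]
      exact neg_add_cancel _
    · intro h
      have h1 : (u : MvPolynomial σ K) + f * r = 0 := by
        rw [← hp (u, r), h]
        rfl
      have h2 : f * (r : MvPolynomial σ K) = -u := (neg_eq_of_add_eq_zero_right h1).symm
      have h3 : (r : MvPolynomial σ K) ∈ idealComponent w I d := by
        refine ⟨hreg r ?_, r.2⟩
        rw [h2]
        exact I.neg_mem u.2.1
      refine ⟨⟨r, h3⟩, ?_⟩
      have h4 : (i ⟨r, h3⟩).1 = u := Subtype.ext (by rw [hi1, h2, neg_neg])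
      have h5 : (i ⟨r, h3⟩).2 = r := Subtype.ext (by rw [hi2])
      exact Prod.ext h4 h5
  · refine LinearMap.ext fun x => ?_
    have h1 : ((restrict g (hA (e + d))).prodMap (restrict g hB) (i x)).1 =
        (i (restrict g (hA d) x)).1 := Subtype.ext (by
      rw [hi1, LinearMap.prodMap_apply, LinearMap.coe_restrict_apply, hi1, map_neg, hgf,
        LinearMap.coe_restrict_apply])
    have h2 : ((restrict g (hA (e + d))).prodMap (restrict g hB) (i x)).2 =
        (i (restrict g (hA d) x)).2 := Subtype.ext (by
      rw [hi2, LinearMap.prodMap_apply, LinearMap.coe_restrict_apply, hi2,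
        LinearMap.coe_restrict_apply])
    exact Prod.ext h1 h2
  · refine LinearMap.ext fun x => Subtype.ext ?_
    rw [LinearMap.comp_apply, hp, LinearMap.comp_apply, LinearMap.coe_restrict_apply, hp, map_add,
      hgf, LinearMap.prodMap_apply, LinearMap.coe_restrict_apply, LinearMap.coe_restrict_apply]

/-- A multiple of `f` has no component in a degree that does not dominate `e`. -/
theorem idealComponent_sup_of_not_le (hI : ∀ P ∈ I, ∀ d, weightedHomogeneousComponent w d P ∈ I)
    (hf : IsWeightedHomogeneous w f e) {d : τ →₀ ℕ} (hd : ¬ e ≤ d) :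
    idealComponent w (I ⊔ Ideal.span {f}) d = idealComponent w I d := by
  refine le_antisymm ?_ fun P hP => ⟨Submodule.mem_sup_left hP.1, hP.2⟩
  rintro P ⟨hP, hPd⟩
  refine ⟨?_, hPd⟩
  obtain ⟨a, ha, b, hb, rfl⟩ := Submodule.mem_sup.mp hP
  obtain ⟨r, rfl⟩ := Ideal.mem_span_singleton.mp hb
  have h := IsWeightedHomogeneous.weightedHomogeneousComponent_same hPd
  rw [map_add, weightedHomogeneousComponent_mul_of_not_le hf hd, add_zero] at h
  rw [← h]
  exact hI a ha d

/-- In degree `e + d` the trace on the quotient drops by the trace on `(R/I)_d`, which is what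
multiplication by `f` embeds there. In degrees not above `e` nothing changes. -/
theorem quotientTraceSeries_sup (hfin : ∀ d, {m : σ →₀ ℕ | Finsupp.weight w m = d}.Finite)
    (hg : ∀ d P, IsWeightedHomogeneous w P d → IsWeightedHomogeneous w (g P) d)
    (hgf : ∀ P, g (f * P) = f * g P) (hgI : ∀ P ∈ I, g P ∈ I)
    (hI : ∀ P ∈ I, ∀ d, weightedHomogeneousComponent w d P ∈ I)
    (hf : IsWeightedHomogeneous w f e) (hreg : ∀ P, f * P ∈ I → P ∈ I) :
    quotientTraceSeries w g (I ⊔ Ideal.span {f}) =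
      (1 - MvPowerSeries.monomial e 1) * quotientTraceSeries w g I := by
  classical
  ext d
  rw [sub_mul, one_mul, map_sub, MvPowerSeries.coeff_monomial_mul]
  split_ifs with h
  · obtain ⟨d, rfl⟩ := exists_add_of_le h
    rw [add_tsub_cancel_left]
    have h := traceOn_idealComponent_sup hfin hg hgf hgI hI hf hreg d
    change _ - traceOn g _ = (_ - traceOn g _) - 1 * (traceOn g _ - traceOn g _)
    rw [eq_sub_of_add_eq h]
    ring
  · rw [sub_zero]
    change _ - traceOn g _ = _ - traceOn g _
    rw [idealComponent_sup_of_not_le hI hf h]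

/-- The graded traces on the quotient by a regular sequence of invariant homogeneous elements. -/
theorem quotientTraceSeries_span (g : MvPolynomial σ K →ₐ[K] MvPolynomial σ K)
    {ι : Type*} {f : ι → MvPolynomial σ K} {e : ι → τ →₀ ℕ}
    (hfin : ∀ d, {m : σ →₀ ℕ | Finsupp.weight w m = d}.Finite)
    (hg : ∀ d P, IsWeightedHomogeneous w P d → IsWeightedHomogeneous w (g P) d)
    (hgf : ∀ v, g (f v) = f v) (hf : ∀ v, IsWeightedHomogeneous w (f v) (e v))
    (hreg : ∀ (s : Set ι) v, v ∉ s → ∀ P, f v * P ∈ Ideal.span (f '' s) → P ∈ Ideal.span (f '' s))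
    (s : Finset ι) :
    quotientTraceSeries w g.toLinearMap (Ideal.span (f '' s)) =
      (∏ v ∈ s, (1 - MvPowerSeries.monomial (e v) 1)) *
        quotientTraceSeries w g.toLinearMap ⊥ := by
  classical
  induction s using Finset.induction_on with
  | empty => simp
  | insert v s hv ih =>
    have hsup : Ideal.span (f '' (insert v s : Finset ι)) =
        Ideal.span (f '' s) ⊔ Ideal.span {f v} := by
      rw [Finset.coe_insert, Set.image_insert_eq, Ideal.span_insert, sup_comm]
    rw [hsup, Finset.prod_insert hv, mul_assoc, ← ih]
    refine quotientTraceSeries_sup hfin hg ?_ ?_ ?_ (hf v) (hreg s v (by simpa using hv))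
    · intro P
      change g (f v * P) = f v * g P
      rw [map_mul, hgf]
    · intro P hP
      induction hP using Submodule.span_induction with
      | mem x hx =>
        obtain ⟨u, hu, rfl⟩ := hx
        exact (hgf u).symm ▸ Ideal.subset_span ⟨u, hu, rfl⟩
      | zero => rw [map_zero]; exact zero_mem _
      | add x y _ _ hx hy => rw [map_add]; exact add_mem hx hy
      | smul a x hx h =>
        change g (a * x) ∈ _
        rw [map_mul]
        exact Ideal.mul_mem_left _ _ h
    · intro P hP d
      refine weightedHomogeneousComponent_mem_span ?_ hP d
      rintro _ ⟨u, -, rfl⟩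
      exact ⟨e u, hf u⟩

theorem coeff_quotientTraceSeries_bot (d : τ →₀ ℕ) :
    MvPowerSeries.coeff d (quotientTraceSeries w g ⊥) =
      traceOn g (weightedHomogeneousSubmodule K w d) := by
  have h : idealComponent w (⊥ : Ideal (MvPolynomial σ K)) d = ⊥ := by
    rw [idealComponent, Submodule.restrictScalars_bot, bot_inf_eq]
  change _ - traceOn g _ = _
  have h0 : traceOn g (⊥ : Submodule K (MvPolynomial σ K)) = 0 := by
    rw [traceOn_eq (by simp), Subsingleton.elim (g.restrict _) 0, map_zero]
  rw [h, h0]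
  exact sub_zero _

/-- The trace of a permutation of the variables on a homogeneous component is the number of
monomials fixed by it. -/
theorem traceOn_rename (hfin : ∀ d, {m : σ →₀ ℕ | Finsupp.weight w m = d}.Finite)
    (p : Equiv.Perm σ) (hg : ∀ d P, IsWeightedHomogeneous w P d →
      IsWeightedHomogeneous w (rename (R := K) p P) d) (d : τ →₀ ℕ) :
    traceOn (rename (R := K) p).toLinearMap (weightedHomogeneousSubmodule K w d) =
      ({m : σ →₀ ℕ | Finsupp.weight w m = d ∧ m.mapDomain p = m}.ncard : K) := by
  classical
  have := (hfin d).fintype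
  let b : Module.Basis {m : σ →₀ ℕ | Finsupp.weight w m = d} K
      (weightedHomogeneousSubmodule K w d) := Module.Basis.ofEquivFun
    { toFun := fun P m => coeff m.1 P.1
      map_add' := fun P Q => by ext; simp
      map_smul' := fun c P => by ext; simp
      invFun := fun c => ⟨∑ m : {m : σ →₀ ℕ | Finsupp.weight w m = d}, monomial m.1 (c m),
        Submodule.sum_mem _ fun m _ =>
        isWeightedHomogeneous_monomial w m.1 _ m.2⟩
      left_inv := by
        rintro ⟨P, hP⟩
        refine Subtype.ext (MvPolynomial.ext _ _ fun m => ?_)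
        rw [coeff_sum]
        simp only [coeff_monomial]
        by_cases hm : Finsupp.weight w m = d
        · rw [Finset.sum_eq_single ⟨m, hm⟩]
          · simp
          · intro u _ hu
            exact if_neg fun h => hu (Subtype.ext h)
          · simp
        · rw [hP.coeff_eq_zero m hm]
          refine Finset.sum_eq_zero fun u _ => if_neg ?_
          rintro rfl
          exact hm u.2
      right_inv := by
        intro c
        ext m
        simp only [coeff_sum, coeff_monomial]
        rw [Finset.sum_eq_single m]
        · simp
        · intro u _ hu
          exact if_neg fun h => hu (Subtype.ext h)
        · simp }
  have hb : ∀ m, (b m : MvPolynomial σ K) = monomial m.1 1 := by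
    intro m
    simp only [b, Module.Basis.coe_ofEquivFun]
    change ∑ u, monomial _ _ = _
    rw [Finset.sum_eq_single m]
    · simp
    · intro u _ hu
      simp [hu]
    · simp
  rw [traceOn_eq (hg d), LinearMap.trace_eq_matrix_trace K b, Matrix.trace]
  -- In the monomial basis the map is a permutation matrix, whose diagonal marks the fixed
  -- monomials.
  have hdiag : ∀ m, Matrix.diag (LinearMap.toMatrix b b
      ((rename (R := K) p).toLinearMap.restrict (hg d))) m =
      if m.1.mapDomain p = m.1 then 1 else 0 := by
    intro m
    rw [Matrix.diag_apply, LinearMap.toMatrix_apply]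
    change coeff m.1 (rename p (b m : MvPolynomial σ K)) = _
    rw [hb, rename_monomial, coeff_monomial]
  simp only [hdiag]
  rw [Finset.sum_boole]
  congr 1
  rw [← Set.ncard_coe_finset, ← Set.ncard_image_of_injective _ Subtype.val_injective]
  congr 1
  ext m
  constructor
  · rintro ⟨u, hu, rfl⟩
    exact ⟨u.2, (Finset.mem_filter.mp hu).2⟩
  · rintro ⟨h1, h2⟩
    exact ⟨⟨m, h1⟩, Finset.mem_filter.mpr ⟨Finset.mem_univ _, h2⟩, rfl⟩

end MvPolynomial

/-! ### The scalar product and the character of the harmonics -/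

namespace BigradedFrobenius

open MvPolynomial

/-- The constant is `(a v + 1) ⋯ (a v + k)`. Only its nonvanishing and its independence of `Q`
matter. -/
theorem exists_coeff_pderiv_pow (n : ℕ) (v : Fin n ⊕ Fin n) (k : ℕ) (a : (Fin n ⊕ Fin n) →₀ ℕ) :
    ∃ c : ℂ, c ≠ 0 ∧ ∀ Q : R n,
      coeff a (((pderiv (R := ℂ) v).toLinearMap ^ k : Module.End ℂ (R n)) Q) =
        c * coeff (a + Finsupp.single v k) Q := by
  induction k generalizing a with
  | zero => exact ⟨1, one_ne_zero, fun Q => by simp⟩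
  | succ k ih =>
    obtain ⟨c, hc, h⟩ := ih (a + Finsupp.single v 1)
    refine ⟨(a v + 1 : ℂ) * c, mul_ne_zero (Nat.cast_add_one_ne_zero _) hc, fun Q => ?_⟩
    rw [pow_succ', Module.End.mul_apply]
    refine (coeff_pderiv _ _).trans ?_
    rw [h, add_assoc, ← Finsupp.single_add, add_comm 1 k]
    ring

theorem exists_coeff_noncommProd_pderiv (n : ℕ) (m : (Fin n ⊕ Fin n) →₀ ℕ)
    (s : Finset (Fin n ⊕ Fin n)) (hs : (s : Set (Fin n ⊕ Fin n)).Pairwise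
      (Function.onFun Commute fun v => ((pderiv (R := ℂ) v).toLinearMap ^ m v :
        Module.End ℂ (R n)))) (a : (Fin n ⊕ Fin n) →₀ ℕ) :
    ∃ c : ℂ, c ≠ 0 ∧ ∀ Q : R n,
      coeff a (s.noncommProd _ hs Q) = c * coeff (a + ∑ v ∈ s, Finsupp.single v (m v)) Q := by
  classical
  induction s using Finset.induction_on generalizing a with
  | empty => exact ⟨1, one_ne_zero, fun Q => by simp⟩
  | insert v s hv ih =>
    obtain ⟨c₁, hc₁, h₁⟩ := exists_coeff_pderiv_pow n v (m v) a
    obtain ⟨c₂, hc₂, h₂⟩ := ih (hs.mono (by simp)) (a + Finsupp.single v (m v))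
    refine ⟨c₁ * c₂, mul_ne_zero hc₁ hc₂, fun Q => ?_⟩
    rw [Finset.noncommProd_insert_of_notMem _ _ _ _ hv, Module.End.mul_apply, h₁, h₂,
      Finset.sum_insert hv, mul_assoc, add_assoc]

/-- The monomials are an orthogonal basis for the scalar product. -/
theorem exists_scalarProduct_eq (n : ℕ) :
    ∃ c : ((Fin n ⊕ Fin n) →₀ ℕ) → ℂ, (∀ m, c m ≠ 0) ∧ ∀ P Q : R n,
      scalarProduct n P Q = ∑ m ∈ P.support, P.coeff m * (c m * Q.coeff m) := by
  choose c hc h using fun m : (Fin n ⊕ Fin n) →₀ ℕ =>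
    exists_coeff_noncommProd_pderiv n m Finset.univ
      (fun i _ j _ _ => (pderiv_commute n i j).pow_pow _ _) 0
  refine ⟨c, hc, fun P Q => ?_⟩
  have heval : ∀ Q : R n, eval 0 Q = coeff 0 Q := fun Q => by
    rw [eval_zero]
    rfl
  rw [scalarProduct, diffOp, LinearMap.sum_apply, map_sum]
  refine Finset.sum_congr rfl fun m _ => ?_
  rw [LinearMap.smul_apply, smul_eval, heval]
  refine congrArg _ ((h m Q).trans ?_)
  rw [zero_add, Finsupp.univ_sum_single]

/-- The scalar product as a bilinear form. -/
noncomputable def scalarProductForm (n : ℕ) : R n →ₗ[ℂ] R n →ₗ[ℂ] ℂ :=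
  LinearMap.mk₂ ℂ (scalarProduct n)
    (by
      obtain ⟨c, -, h⟩ := exists_scalarProduct_eq n
      -- Summing over the support of `Q` makes the index set independent of `P`, so additivity in
      -- `P` holds term by term.
      have h' : ∀ P Q : R n, scalarProduct n P Q =
          ∑ m ∈ Q.support, P.coeff m * (c m * Q.coeff m) := by
        classical
        intro P Q
        rw [h]
        refine (Finset.sum_subset Finset.subset_union_left ?_).trans
          (Finset.sum_subset (Finset.subset_union_right (s₁ := P.support)) ?_).symm
        · intro m _ hm
          rw [notMem_support_iff.mp hm, zero_mul]
        · intro m _ hm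
          rw [notMem_support_iff.mp hm, mul_zero, mul_zero]
      intro P P' Q
      simp only [h', coeff_add, add_mul, Finset.sum_add_distrib])
    (by
      obtain ⟨c, -, h⟩ := exists_scalarProduct_eq n
      intro a P Q
      by_cases ha : a = 0
      · simp [h, ha]
      · rw [h, h, support_smul_eq ha, Finset.smul_sum]
        simp only [coeff_smul, smul_eq_mul, mul_assoc])
    (by simp [scalarProduct])
    (by simp [scalarProduct])

/-- The bidegree of a variable. -/
noncomputable def bidegree (n : ℕ) : Fin n ⊕ Fin n → Fin 2 →₀ ℕ :=
  Sum.elim (fun _ => Finsupp.single 0 1) (fun _ => Finsupp.single 1 1)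

theorem weight_bidegree_eq_iff (n : ℕ) (m : (Fin n ⊕ Fin n) →₀ ℕ) (d : Fin 2 →₀ ℕ) :
    Finsupp.weight (bidegree n) m = d ↔ ∑ i, m (Sum.inl i) = d 0 ∧ ∑ i, m (Sum.inr i) = d 1 := by
  have h0 : Finsupp.weight (bidegree n) m 0 = ∑ i, m (Sum.inl i) := by
    rw [Finsupp.weight_apply, Finsupp.sum_fintype _ _ (by simp), Finsupp.finsetSum_apply]
    simp [bidegree]
  have h1 : Finsupp.weight (bidegree n) m 1 = ∑ i, m (Sum.inr i) := by
    rw [Finsupp.weight_apply, Finsupp.sum_fintype _ _ (by simp), Finsupp.finsetSum_apply]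
    simp [bidegree]
  rw [← h0, ← h1]
  constructor
  · rintro rfl
    exact ⟨rfl, rfl⟩
  · rintro ⟨h0, h1⟩
    ext i
    fin_cases i
    · exact h0
    · exact h1

/-- Passes to degrees in `Fin 2 →₀ ℕ`, which are also the exponents of the series in `q` and `t`. -/
theorem bidegreeProj_eq (n : ℕ) (d : Fin 2 →₀ ℕ) :
    bidegreeProj n (d 0) (d 1) = weightedHomogeneousComponent (bidegree n) d := by
  classical
  refine LinearMap.ext fun P => MvPolynomial.ext _ _ fun m => ?_
  rw [bidegreeProj, coeff_weightedHomogeneousComponent, coeff_weightedHomogeneousComponent]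
  refine if_congr ?_ rfl rfl
  rw [weight_bidegree_eq_iff, Finsupp.weight_apply, Finsupp.sum_fintype _ _ (by simp), Prod.ext_iff,
    Prod.fst_sum, Prod.snd_sum]
  simp

theorem finite_weight_bidegree (n : ℕ) (d : Fin 2 →₀ ℕ) :
    {m : (Fin n ⊕ Fin n) →₀ ℕ | Finsupp.weight (bidegree n) m = d}.Finite := by
  refine (Set.finite_Iic (Finsupp.equivFunOnFinite.symm fun _ => d 0 + d 1)).subset ?_
  intro m hm
  obtain ⟨h0, h1⟩ := (weight_bidegree_eq_iff n m d).mp hm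
  rintro (i | i)
  · have := Finset.single_le_sum (f := fun i => m (Sum.inl i)) (fun _ _ => Nat.zero_le _)
      (Finset.mem_univ i)
    simp at this ⊢
    omega
  · have := Finset.single_le_sum (f := fun i => m (Sum.inr i)) (fun _ _ => Nat.zero_le _)
      (Finset.mem_univ i)
    simp at this ⊢
    omega

theorem isWeightedHomogeneous_esymmSum (n : ℕ) (v : Fin n ⊕ Fin n) :
    IsWeightedHomogeneous (bidegree n) (esymmSum ℂ n v)
      (Sum.elim (fun i : Fin n => Finsupp.single 0 ((i : ℕ) + 1))
        (fun i : Fin n => Finsupp.single 1 ((i : ℕ) + 1)) v) := by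
  have h : ∀ (f : Fin n → Fin n ⊕ Fin n) (j : Fin 2)
      (_ : ∀ i, bidegree n (f i) = Finsupp.single j 1) (k : ℕ),
      IsWeightedHomogeneous (bidegree n) (rename f (esymm (Fin n) ℂ k)) (Finsupp.single j k) := by
    intro f j hf k
    rw [esymm, map_sum]
    refine IsWeightedHomogeneous.sum _ _ _ fun s hs => ?_
    rw [map_prod]
    simp only [rename_X]
    have h1 := IsWeightedHomogeneous.prod s (fun i => (X (f i) : R n)) (fun _ => Finsupp.single j 1)
      (w := bidegree n) fun i _ => hf i ▸ isWeightedHomogeneous_X ℂ _ (f i)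
    rwa [Finset.sum_const, (Finset.mem_powersetCard.mp hs).2, Finsupp.smul_single, smul_eq_mul,
      mul_one] at h1
  rcases v with i | i
  · exact h _ 0 (fun _ => rfl) _
  · exact h _ 1 (fun _ => rfl) _

theorem weightedHomogeneousComponent_mem_invariantIdeal (n : ℕ) {P : R n}
    (hP : P ∈ invariantIdeal n) (d : Fin 2 →₀ ℕ) :
    weightedHomogeneousComponent (bidegree n) d P ∈ invariantIdeal n := by
  rw [invariantIdeal_eq] at hP ⊢
  refine weightedHomogeneousComponent_mem_span ?_ hP d
  rintro _ ⟨v, rfl⟩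
  exact ⟨_, isWeightedHomogeneous_esymmSum n v⟩

theorem isWeightedHomogeneous_diagonalAction (n : ℕ) (σ : Equiv.Perm (Fin n)) (d : Fin 2 →₀ ℕ)
    (P : R n) (hP : IsWeightedHomogeneous (bidegree n) P d) :
    IsWeightedHomogeneous (bidegree n) (diagonalAction n σ P) d := by
  have h := bidegreeProj_diagonalAction n (d 0) (d 1) σ P
  rw [bidegreeProj_eq, hP.weightedHomogeneousComponent_same] at h
  rw [← h]
  exact weightedHomogeneousComponent_isWeightedHomogeneous _ _

/-- The projection merely selects monomials, and these are orthogonal. -/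
theorem scalarProduct_weightedHomogeneousComponent (n : ℕ) (d : Fin 2 →₀ ℕ) (P Q : R n) :
    scalarProduct n P (weightedHomogeneousComponent (bidegree n) d Q) =
      scalarProduct n (weightedHomogeneousComponent (bidegree n) d P) Q := by
  classical
  obtain ⟨c, -, h⟩ := exists_scalarProduct_eq n
  rw [h, h, support_weightedHomogeneousComponent, Finset.sum_filter]
  refine Finset.sum_congr rfl fun m _ => ?_
  rw [coeff_weightedHomogeneousComponent, coeff_weightedHomogeneousComponent]
  split_ifs <;> simp

/-- As `𝓘` is bihomogeneous and the projections are self-adjoint, orthogonality to `𝓘` can be tested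
one bidegree at a time. -/
theorem mem_component_harmonics (n : ℕ) (d : Fin 2 →₀ ℕ) (Q : R n) :
    Q ∈ (component (harmonics n) (d 0) (d 1)).toSubmodule ↔
      IsWeightedHomogeneous (bidegree n) Q d ∧
        ∀ P ∈ idealComponent (bidegree n) (invariantIdeal n) d, scalarProduct n P Q = 0 := by
  constructor
  · rintro ⟨Q, hQ, rfl⟩
    rw [bidegreeProj_eq]
    refine ⟨weightedHomogeneousComponent_isWeightedHomogeneous _ _, fun P hP => ?_⟩
    rw [scalarProduct_weightedHomogeneousComponent]
    exact hQ _ (weightedHomogeneousComponent_mem_invariantIdeal n hP.1 d)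
  · rintro ⟨hQd, hQ⟩
    have hsame := hQd.weightedHomogeneousComponent_same
    refine ⟨Q, fun P hP => ?_, by rw [bidegreeProj_eq, hsame]⟩
    rw [← hsame, scalarProduct_weightedHomogeneousComponent]
    exact hQ _ ⟨weightedHomogeneousComponent_mem_invariantIdeal n hP d,
      weightedHomogeneousComponent_isWeightedHomogeneous _ _⟩

/-- Every linear form on a space of homogeneous polynomials is given by the scalar product with a
homogeneous polynomial. -/
theorem exists_scalarProduct_eq_apply (n : ℕ) (d : Fin 2 →₀ ℕ) (φ : R n →ₗ[ℂ] ℂ) :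
    ∃ Q : R n, IsWeightedHomogeneous (bidegree n) Q d ∧
      ∀ P, IsWeightedHomogeneous (bidegree n) P d → scalarProduct n P Q = φ P := by
  classical
  obtain ⟨c, hc, h⟩ := exists_scalarProduct_eq n
  let S := (finite_weight_bidegree n d).toFinset
  have hS : ∀ m, m ∈ S ↔ Finsupp.weight (bidegree n) m = d := fun m => by simp [S]
  -- Dual-basis expansion: distinct monomials are orthogonal and the monomial `m` pairs with itself
  -- to `c m`.
  refine ⟨∑ m ∈ S, monomial m (φ (monomial m 1) / c m), ?_, ?_⟩
  · exact IsWeightedHomogeneous.sum _ _ _ fun m hm =>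
      isWeightedHomogeneous_monomial _ _ _ ((hS m).mp hm)
  · intro P hP
    rw [h]
    conv_rhs => rw [← support_sum_monomial_coeff P, map_sum]
    refine Finset.sum_congr rfl fun m hm => ?_
    have hmS : m ∈ S := (hS m).mpr (hP (mem_support_iff.mp hm))
    rw [coeff_sum]
    simp only [coeff_monomial]
    rw [Finset.sum_ite_eq' S m, if_pos hmS, mul_div_cancel₀ _ (hc m), ← mul_one (coeff m P),
      ← smul_eq_mul (coeff m P) 1, ← smul_monomial, map_smul, smul_eq_mul, smul_eq_mul, mul_one]

/-- Sending `Q` to `⟨·, Q⟩` gives an exact sequence `0 → H_d → R_d → (𝓘_d)^* → 0`. Invariance of the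
pairing makes `σ` act on the dual as the transpose of `σ⁻¹`, whence the inverse. -/
theorem character_component_harmonics_eq_sub (n : ℕ) (σ : Equiv.Perm (Fin n)) (d : Fin 2 →₀ ℕ) :
    (component (harmonics n) (d 0) (d 1)).toRepresentation.character σ =
      LinearMap.traceOn (diagonalAction n σ) (weightedHomogeneousSubmodule ℂ (bidegree n) d) -
        LinearMap.traceOn (diagonalAction n σ⁻¹)
          (idealComponent (bidegree n) (invariantIdeal n) d) := by
  have hfd := finiteDimensional_weightedHomogeneousSubmodule (K := ℂ) (finite_weight_bidegree n d)
  have hfd' : FiniteDimensional ℂ (idealComponent (bidegree n) (invariantIdeal n) d) :=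
    Submodule.finiteDimensional_of_le (S₂ := weightedHomogeneousSubmodule ℂ (bidegree n) d)
      fun P hP => hP.2
  have hB : ∀ P ∈ weightedHomogeneousSubmodule ℂ (bidegree n) d,
      diagonalAction n σ P ∈ weightedHomogeneousSubmodule ℂ (bidegree n) d :=
    isWeightedHomogeneous_diagonalAction n σ d
  have hI : ∀ P ∈ idealComponent (bidegree n) (invariantIdeal n) d,
      diagonalAction n σ⁻¹ P ∈ idealComponent (bidegree n) (invariantIdeal n) d := fun P hP =>
    ⟨diagonalAction_mem_invariantIdeal n _ hP.1,
      isWeightedHomogeneous_diagonalAction n _ d P hP.2⟩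
  have hle : (component (harmonics n) (d 0) (d 1)).toSubmodule ≤
      weightedHomogeneousSubmodule ℂ (bidegree n) d :=
    fun Q hQ => ((mem_component_harmonics n d Q).mp hQ).1
  rw [LinearMap.traceOn_eq hB, LinearMap.traceOn_eq hI, eq_sub_iff_add_eq, eq_comm,
    ← LinearMap.trace_transpose' (LinearMap.restrict (diagonalAction n σ⁻¹) hI)]
  obtain ⟨p, hp⟩ : ∃ p : weightedHomogeneousSubmodule ℂ (bidegree n) d →ₗ[ℂ]
      Module.Dual ℂ (idealComponent (bidegree n) (invariantIdeal n) d),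
      ∀ Q P, p Q P = scalarProduct n P Q :=
    ⟨((scalarProductForm n).domRestrict₁₂ (idealComponent (bidegree n) (invariantIdeal n) d)
      (weightedHomogeneousSubmodule ℂ (bidegree n) d)).flip, fun Q P => rfl⟩
  refine LinearMap.trace_eq_add_of_exact (f := Submodule.inclusion hle) (g := p)
    (Submodule.inclusion_injective hle) ?_ ?_ ?_ ?_
  · intro φ
    obtain ⟨φ', hφ'⟩ := LinearMap.exists_extend φ
    obtain ⟨Q, hQ, h⟩ := exists_scalarProduct_eq_apply n d φ'
    refine ⟨⟨Q, hQ⟩, LinearMap.ext fun P => ?_⟩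
    rw [hp, ← hφ']
    exact h P P.2.2
  · ext Q
    rw [Submodule.range_inclusion, LinearMap.mem_ker, Submodule.mem_comap]
    refine (mem_component_harmonics n d Q).trans ⟨fun h => ?_, fun h => ⟨Q.2, fun P hP => ?_⟩⟩
    · refine LinearMap.ext fun P => ?_
      rw [hp]
      exact h.2 P P.2
    · have h1 := DFunLike.congr_fun h ⟨P, hP⟩
      rwa [hp] at h1
  · rfl
  · refine LinearMap.ext fun Q => LinearMap.ext fun P => ?_
    rw [LinearMap.comp_apply, hp, LinearMap.comp_apply, Module.Dual.transpose_apply,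
      LinearMap.comp_apply, hp, LinearMap.coe_restrict_apply, LinearMap.coe_restrict_apply,
      ← scalarProduct_diagonalAction n σ (diagonalAction n σ⁻¹ P) Q, ← Module.End.mul_apply,
      ← map_mul, mul_inv_cancel, map_one, Module.End.one_apply]

theorem prod_one_sub_monomial (n : ℕ) :
    ∏ v : Fin n ⊕ Fin n, (1 - MvPowerSeries.monomial
      (Sum.elim (fun i : Fin n => Finsupp.single 0 ((i : ℕ) + 1))
        (fun i : Fin n => Finsupp.single 1 ((i : ℕ) + 1)) v) 1 : QT) = qPoch q n * qPoch t n := by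
  rw [Fintype.prod_sum_type, qPoch, qPoch, ← Fin.prod_univ_eq_prod_range (fun i => 1 - q ^ (i + 1)),
    ← Fin.prod_univ_eq_prod_range (fun i => 1 - t ^ (i + 1))]
  simp only [Sum.elim_inl, Sum.elim_inr, q, t, MvPowerSeries.X_pow_eq]

/-- The generating function of the monomials fixed by a permutation. -/
noncomputable def fixedMonomialSeries {n : ℕ} (σ : Equiv.Perm (Fin n)) : QT := fun d =>
  ({m : (Fin n ⊕ Fin n) →₀ ℕ | Finsupp.weight (bidegree n) m = d ∧
    m.mapDomain (Equiv.sumCongr σ σ) = m}.ncard : ℂ)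

/-- A permutation and its inverse fix the same monomials; this absorbs the inverse introduced by
duality. -/
theorem fixedMonomialSeries_inv {n : ℕ} (σ : Equiv.Perm (Fin n)) :
    fixedMonomialSeries σ⁻¹ = fixedMonomialSeries σ := by
  have h : ∀ (σ : Equiv.Perm (Fin n)) (m : (Fin n ⊕ Fin n) →₀ ℕ),
      m.mapDomain (Equiv.sumCongr σ σ) = m → m.mapDomain (Equiv.sumCongr σ⁻¹ σ⁻¹) = m := by
    intro σ m hm
    conv_lhs => rw [← hm]
    rw [← Finsupp.mapDomain_comp]
    convert Finsupp.mapDomain_id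
    ext (i | i) <;> simp
  funext d
  rw [fixedMonomialSeries, fixedMonomialSeries]
  congr 3
  ext m
  refine and_congr_right fun _ => ⟨fun hm => ?_, h σ m⟩
  have := h σ⁻¹ m hm
  rwa [inv_inv] at this

/-- The bigraded character of the harmonics. -/
theorem character_component_harmonics (n : ℕ) (σ : Equiv.Perm (Fin n)) (d : Fin 2 →₀ ℕ) :
    (component (harmonics n) (d 0) (d 1)).toRepresentation.character σ =
      MvPowerSeries.coeff d (qPoch q n * qPoch t n * fixedMonomialSeries σ) := by
  have hfix : ∀ σ : Equiv.Perm (Fin n),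
      LinearMap.traceOn (diagonalAction n σ) (weightedHomogeneousSubmodule ℂ (bidegree n) d) =
        MvPowerSeries.coeff d (fixedMonomialSeries σ) := fun σ =>
    traceOn_rename (finite_weight_bidegree n) (Equiv.sumCongr σ σ)
      (isWeightedHomogeneous_diagonalAction n σ) d
  have hser := quotientTraceSeries_span (rename (R := ℂ) (Equiv.sumCongr σ⁻¹ σ⁻¹))
    (finite_weight_bidegree n) (isWeightedHomogeneous_diagonalAction n σ⁻¹) (f := esymmSum ℂ n) ?_
    (isWeightedHomogeneous_esymmSum n) (fun s v hv P hP => mem_span_esymmSum_of_mul_mem hv hP)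
    Finset.univ
  · rw [prod_one_sub_monomial, Finset.coe_univ, Set.image_univ, ← invariantIdeal_eq] at hser
    have hbot : quotientTraceSeries (bidegree n)
        (rename (R := ℂ) (Equiv.sumCongr σ⁻¹ σ⁻¹)).toLinearMap ⊥ = fixedMonomialSeries σ := by
      ext d
      rw [coeff_quotientTraceSeries_bot, ← fixedMonomialSeries_inv]
      exact traceOn_rename (finite_weight_bidegree n) (Equiv.sumCongr σ⁻¹ σ⁻¹)
        (isWeightedHomogeneous_diagonalAction n σ⁻¹) d
    rw [hbot] at hser
    -- The trace of `σ` on the full component is exchanged for that of `σ⁻¹`, so that both terms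
    -- belong to the quotient series of `σ⁻¹`.
    rw [character_component_harmonics_eq_sub, hfix, ← hser, ← fixedMonomialSeries_inv, ← hfix]
    rfl
  · have h : ∀ f : Fin n → Fin n ⊕ Fin n,
        (Equiv.sumCongr σ⁻¹ σ⁻¹) ∘ f = f ∘ (σ⁻¹ : Equiv.Perm (Fin n)) →
        ∀ k, rename (Equiv.sumCongr σ⁻¹ σ⁻¹) (rename f (esymm (Fin n) ℂ k)) =
          rename f (esymm (Fin n) ℂ k) := by
      intro f hf k
      rw [rename_rename, hf, ← rename_rename, esymm_isSymmetric]
    rintro (i | i)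
    · exact h _ rfl _
    · exact h _ rfl _

end BigradedFrobenius

/-! ### Cycle type as the list of orbit sizes -/

namespace Equiv.Perm

variable {α : Type*} [Fintype α] [DecidableEq α]

/-- Orbits with more than one point correspond to the cycle factors through `cycleOf`; the remaining
orbits are the fixed points, which account for the parts equal to `1`. -/
theorem prod_parts_partition {M : Type*} [CommMonoid M] (σ : Perm α) (G : ℕ → M)
    [Fintype (Quotient (SameCycle.setoid σ))] :
    (σ.partition.parts.map G).prod =
      ∏ o : Quotient (SameCycle.setoid σ), G {i | Quotient.mk _ i = o}.ncard := by
  classical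
  let C : Quotient (SameCycle.setoid σ) → Perm α :=
    Quotient.lift (fun i => σ.cycleOf i) fun i j h => SameCycle.cycleOf_eq h
  have hmk : ∀ i j : α, (Quotient.mk (SameCycle.setoid σ) i = Quotient.mk _ j) ↔
      σ.SameCycle i j := fun i j => Quotient.eq
  rw [parts_partition, Multiset.map_add, Multiset.prod_add, Multiset.map_replicate,
    Multiset.prod_replicate, ← Finset.prod_filter_mul_prod_filter_not Finset.univ (fun o => C o ≠ 1)]
  congr 1
  · rw [cycleType_def, Multiset.map_map]
    symm
    refine Finset.prod_bij (fun o _ => C o) ?_ ?_ ?_ ?_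
    · intro o ho
      induction o using Quotient.inductionOn with
      | _ i => exact cycleOf_ne_one_iff_mem_cycleFactorsFinset.mp (Finset.mem_filter.mp ho).2
    · intro o ho o' ho' h
      induction o using Quotient.inductionOn with
      | _ i =>
      induction o' using Quotient.inductionOn with
      | _ j =>
        have hi : σ i ≠ i := fun h => (Finset.mem_filter.mp ho).2 ((cycleOf_eq_one_iff σ).mpr h)
        rw [hmk, sameCycle_iff_cycleOf_eq_of_mem_support (mem_support.mpr hi)
          (mem_support.mpr fun h => (Finset.mem_filter.mp ho').2 ((cycleOf_eq_one_iff σ).mpr h))]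
        exact h
    · intro c hc
      obtain ⟨i, hi⟩ := (mem_cycleFactorsFinset_iff.mp hc).1.nonempty_support
      have h := cycle_is_cycleOf hi hc
      refine ⟨Quotient.mk _ i, Finset.mem_filter.mpr ⟨Finset.mem_univ _, ?_⟩, h.symm⟩
      change σ.cycleOf i ≠ 1
      rw [← h]
      exact (mem_cycleFactorsFinset_iff.mp hc).1.ne_one
    · intro o ho
      induction o using Quotient.inductionOn with
      | _ i =>
        have hi : σ i ≠ i := fun h => (Finset.mem_filter.mp ho).2 ((cycleOf_eq_one_iff σ).mpr h)
        rw [Function.comp_apply, Function.comp_apply, ← Set.ncard_coe_finset]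
        congr 2
        ext j
        rw [Finset.mem_coe]
        change Quotient.mk _ j = Quotient.mk _ i ↔ j ∈ (σ.cycleOf i).support
        rw [mem_support_cycleOf_iff' hi, hmk]
        exact ⟨SameCycle.symm, SameCycle.symm⟩
  · have h1 : ∀ o ∈ Finset.univ.filter (fun o => ¬ C o ≠ 1),
        G {i | Quotient.mk (SameCycle.setoid σ) i = o}.ncard = G 1 := by
      intro o ho
      induction o using Quotient.inductionOn with
      | _ i =>
        have hi : σ i = i := (cycleOf_eq_one_iff σ).mp (not_not.mp (Finset.mem_filter.mp ho).2)
        congr 1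
        rw [Set.ncard_eq_one]
        refine ⟨i, Set.ext fun j => ?_⟩
        change Quotient.mk _ j = Quotient.mk _ i ↔ j = i
        rw [hmk]
        exact ⟨fun h => (h.symm.eq_of_left hi).symm, fun h => h ▸ SameCycle.refl _ _⟩
    rw [Finset.prod_congr rfl h1, Finset.prod_const]
    congr 1
    rw [← Finset.card_compl]
    refine Finset.card_bij (fun i _ => Quotient.mk _ i) ?_ ?_ ?_
    · intro i hi
      rw [Finset.mem_compl, notMem_support] at hi
      exact Finset.mem_filter.mpr ⟨Finset.mem_univ _, not_not.mpr ((cycleOf_eq_one_iff σ).mpr hi)⟩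
    · intro i hi j _ h
      rw [Finset.mem_compl, notMem_support] at hi
      exact ((hmk i j).mp h).eq_of_left hi
    · intro o ho
      induction o using Quotient.inductionOn with
      | _ i =>
        refine ⟨i, ?_, rfl⟩
        rw [Finset.mem_compl, notMem_support]
        exact (cycleOf_eq_one_iff σ).mp (not_not.mp (Finset.mem_filter.mp ho).2)

end Equiv.Perm

/-! ### Invariant functions, Burnside's lemma and geometric series -/

namespace BigradedFrobenius

open Classical in
/-- The generating function `∑_c X ^ (ℓ • δ c)`, for injective `δ`. -/
noncomputable def powerSeriesOfWeights (K : Type*) [CommRing K] {τ : Type*} (δ : ℕ → τ →₀ ℕ)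
    (l : ℕ) :
    MvPowerSeries τ K :=
  fun d => if ∃ c, d = l • δ c then 1 else 0

/-- The product over the cycles of `σ` of the series `∑_c X ^ (ℓ • δ c)` is the generating function
of the `σ`-invariant functions. -/
theorem coeff_prod_parts_partition (K : Type*) [CommRing K] {τ : Type*} {δ : ℕ → τ →₀ ℕ}
    (hδ : Function.Injective δ) {α : Type*} [Fintype α] [DecidableEq α] (σ : Equiv.Perm α)
    (d : τ →₀ ℕ) :
    MvPowerSeries.coeff d (σ.partition.parts.map (powerSeriesOfWeights K δ)).prod =
      ({f : α → ℕ | f ∘ σ = f ∧ ∑ i, δ (f i) = d}.ncard : K) := by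
  classical
  let O := Quotient (Equiv.Perm.SameCycle.setoid σ)
  let N : O → ℕ := fun o => {i | Quotient.mk _ i = o}.ncard
  have hN : ∀ o, N o ≠ 0 := by
    intro o
    induction o using Quotient.inductionOn with
    | _ i =>
      refine ((Set.ncard_pos (Set.toFinite _)).mpr ⟨i, ?_⟩).ne'
      rfl
  have hsum : ∀ g : O → ℕ, ∑ i, δ (g (Quotient.mk _ i)) = ∑ o, N o • δ (g o) := by
    intro g
    rw [← Finset.sum_fiberwise Finset.univ (fun i => (Quotient.mk _ i : O))]
    refine Finset.sum_congr rfl fun o _ => ?_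
    rw [Finset.sum_congr rfl (g := fun _ => δ (g o))
      fun i hi => by rw [(Finset.mem_filter.mp hi).2], Finset.sum_const]
    congr 1
    rw [← Set.ncard_coe_finset]
    congr 1
    ext
    simp
  let A : Set (O → ℕ) := {g | ∑ o, N o • δ (g o) = d}
  -- Invariant functions are exactly the functions on the set of cycles.
  have hA : {f : α → ℕ | f ∘ σ = f ∧ ∑ i, δ (f i) = d} =
      (fun g : O → ℕ => g ∘ Quotient.mk _) '' A := by
    ext f
    constructor
    · rintro ⟨hf, hd⟩
      have hz : ∀ i j, σ.SameCycle i j → f i = f j := by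
        rintro i _ ⟨k, rfl⟩
        suffices h : ∀ x, f ((σ ^ k) x) = f x from (h i).symm
        induction k using Int.induction_on with
        | zero => intro x; rfl
        | succ k ih =>
          intro x
          rw [zpow_add_one, Equiv.Perm.mul_apply, ih]
          exact congrFun hf x
        | pred k ih =>
          intro x
          rw [zpow_sub_one, Equiv.Perm.mul_apply, ih]
          have h := congrFun hf (σ⁻¹ x)
          rw [← h]
          simp
      refine ⟨Quotient.lift f hz, ?_, rfl⟩
      change ∑ o, N o • δ _ = d
      rw [← hsum]
      exact hd
    · rintro ⟨g, hg, rfl⟩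
      refine ⟨funext fun i => congrArg g ?_, (hsum g).trans hg⟩
      exact Quotient.sound (Equiv.Perm.sameCycle_apply_left.mpr (Equiv.Perm.SameCycle.refl _ _))
  rw [hA, Set.ncard_image_of_injective _ (Quotient.mk_surjective.injective_comp_right),
    Equiv.Perm.prod_parts_partition, MvPowerSeries.coeff_prod]
  have hprod : ∀ l : O →₀ τ →₀ ℕ, ∏ o, MvPowerSeries.coeff (l o) (powerSeriesOfWeights K δ (N o)) =
      if ∀ o, ∃ c, l o = N o • δ c then 1 else 0 := by
    intro l
    change ∏ o, (if ∃ c, l o = N o • δ c then (1 : K) else 0) = _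
    rw [Finset.prod_ite_zero]
    simp
  rw [Finset.sum_congr rfl fun l _ => hprod l, Finset.sum_boole]
  congr 1
  -- Cycle lengths are nonzero and `δ` is injective, so the exponent chosen on each cycle determines
  -- the value there.
  have hinj : Function.Injective fun g : O → ℕ =>
      Finsupp.equivFunOnFinite.symm fun o => N o • δ (g o) := by
    intro g g' h
    funext o
    have h1 : N o • δ (g o) = N o • δ (g' o) := DFunLike.congr_fun h o
    refine hδ (Finsupp.ext fun i => ?_)
    have h2 := DFunLike.congr_fun h1 i
    rw [Finsupp.smul_apply, Finsupp.smul_apply] at h2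
    exact Nat.eq_of_mul_eq_mul_left (Nat.pos_of_ne_zero (hN o)) h2
  rw [← Set.ncard_image_of_injective A hinj, ← Set.ncard_coe_finset]
  congr 1
  ext l
  rw [Finset.mem_coe, Finset.mem_filter, Finset.mem_finsuppAntidiag]
  constructor
  · rintro ⟨⟨hl, -⟩, h⟩
    choose g hg using h
    refine ⟨g, ?_, Finsupp.ext fun o => (hg o).symm⟩
    change ∑ o, N o • δ (g o) = d
    rw [← hl]
    exact Finset.sum_congr rfl fun o _ => (hg o).symm
  · rintro ⟨g, hg, rfl⟩
    exact ⟨⟨hg, Finset.subset_univ _⟩, fun o => ⟨g o, rfl⟩⟩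

/-- Equal contents mean equinumerous fibres, and bijections between the fibres glue to a
permutation. -/
theorem exists_perm_of_sum_single_eq {n : ℕ} {f f' : Fin n → ℕ}
    (h : ∑ i, Finsupp.single (f i) 1 = ∑ i, Finsupp.single (f' i) 1) :
    ∃ e : Equiv.Perm (Fin n), f' ∘ e = f := by
  classical
  have hcard : ∀ (f : Fin n → ℕ) c, (∑ i, Finsupp.single (f i) 1) c =
      Fintype.card {i // f i = c} := by
    intro f c
    rw [Finsupp.finsetSum_apply, Fintype.card_subtype, Finset.card_filter]
    simp [Finsupp.single_apply]
  have he : ∀ c, Nonempty ({i // f i = c} ≃ {i // f' i = c}) := fun c => by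
    rw [← Fintype.card_eq, ← hcard, ← hcard, h]
  let e := fun c => (he c).some
  refine ⟨(Equiv.sigmaFiberEquiv f).symm.trans
    ((Equiv.sigmaCongrRight e).trans (Equiv.sigmaFiberEquiv f')), funext fun i => ?_⟩
  exact (e (f i) ⟨i, rfl⟩).2

theorem exists_sum_single_eq {n : ℕ} {m : ℕ →₀ ℕ} (h : m.degree = n) :
    ∃ f : Fin n → ℕ, ∑ i, Finsupp.single (f i) 1 = m := by
  induction n generalizing m with
  | zero =>
    refine ⟨Fin.elim0, ?_⟩
    rw [Finsupp.degree_eq_zero_iff] at h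
    simp [h]
  | succ n ih =>
    have hm : m ≠ 0 := by
      rintro rfl
      simp at h
    obtain ⟨c, hc⟩ := Finsupp.support_nonempty_iff.mpr hm
    have hle : Finsupp.single c 1 ≤ m :=
      Finsupp.single_le_iff.mpr (Nat.one_le_iff_ne_zero.mpr (Finsupp.mem_support_iff.mp hc))
    obtain ⟨m', rfl⟩ := exists_add_of_le hle
    rw [map_add, Finsupp.degree_single] at h
    obtain ⟨f, hf⟩ := ih (m := m') (by omega)
    refine ⟨Fin.cons c f, ?_⟩
    rw [Fin.sum_univ_succ]
    simp [hf]

/-- Permutations and functions with a prescribed content that are invariant under them. -/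
theorem sum_ncard_invariant (n : ℕ) (m : ℕ →₀ ℕ) :
    ∑ σ : Equiv.Perm (Fin n), {f : Fin n → ℕ | f ∘ σ = f ∧
      ∑ i, Finsupp.single (f i) 1 = m}.ncard = if m.degree = n then n.factorial else 0 := by
  classical
  let X := {f : Fin n → ℕ // ∑ i, Finsupp.single (f i) 1 = m}
  have hdeg : ∀ f : X, m.degree = n := by
    rintro ⟨f, rfl⟩
    simp
  let act : MulAction (Equiv.Perm (Fin n)) X :=
    { smul := fun σ f => ⟨f.1 ∘ σ.symm,
        (Equiv.sum_comp σ.symm fun i => Finsupp.single (f.1 i) 1).trans f.2⟩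
      one_smul := fun f => rfl
      mul_smul := fun σ τ f => rfl }
  have hsmul : ∀ (σ : Equiv.Perm (Fin n)) (f : X), (σ • f).1 = f.1 ∘ σ.symm := fun σ f => rfl
  have hfix : ∀ σ : Equiv.Perm (Fin n), {f : Fin n → ℕ | f ∘ σ = f ∧
      ∑ i, Finsupp.single (f i) 1 = m}.ncard = Nat.card (MulAction.fixedBy X σ) := by
    intro σ
    rw [Nat.card_coe_set_eq, ← Set.ncard_image_of_injective _ Subtype.val_injective]
    congr 1
    ext f
    constructor
    · rintro ⟨hf, hm⟩
      refine ⟨⟨f, hm⟩, Subtype.ext ?_, rfl⟩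
      rw [hsmul, Equiv.comp_symm_eq]
      exact hf.symm
    · rintro ⟨x, hx, rfl⟩
      have h := congrArg Subtype.val (MulAction.mem_fixedBy.mp hx)
      rw [hsmul, Equiv.comp_symm_eq] at h
      exact ⟨h.symm, x.2⟩
  have hfin : Finite X := by
    refine Set.Finite.to_subtype
      ((Set.Finite.pi' fun _ : Fin n => m.support.finite_toSet).subset ?_)
    rintro f rfl i
    rw [Finset.mem_coe, Finsupp.mem_support_iff, Finsupp.finsetSum_apply]
    refine (Finset.sum_pos' (fun _ _ => Nat.zero_le _) ⟨i, Finset.mem_univ i, ?_⟩).ne'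
    simp
  have := Fintype.ofFinite X
  simp only [hfix, Nat.card_eq_fintype_card]
  -- Burnside's lemma: the functions of content `m` form a single orbit if `m` has degree `n`, and
  -- there are none otherwise.
  rw [MulAction.sum_card_fixedBy_eq_card_orbits_mul_card_group, Fintype.card_perm, Fintype.card_fin]
  split_ifs with h
  · obtain ⟨f, hf⟩ := exists_sum_single_eq h
    have hX : Nonempty X := ⟨⟨f, hf⟩⟩
    have htrans : MulAction.IsPretransitive (Equiv.Perm (Fin n)) X := by
      refine ⟨fun x y => ?_⟩
      obtain ⟨e, he⟩ := exists_perm_of_sum_single_eq (y.2.trans x.2.symm)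
      exact ⟨e.symm, Subtype.ext he⟩
    have h1 := (MulAction.pretransitive_iff_subsingleton_quotient (Equiv.Perm (Fin n)) X).mp htrans
    have h2 : Nonempty (Quotient (MulAction.orbitRel (Equiv.Perm (Fin n)) X)) :=
      hX.map (Quotient.mk _)
    rw [Fintype.card_eq_one_iff_nonempty_unique.mpr ⟨⟨⟨h2.some⟩, fun _ => Subsingleton.elim _ _⟩⟩,
      one_mul]
  · have hX : IsEmpty X := ⟨fun f => h (hdeg f)⟩
    have h2 : IsEmpty (Quotient (MulAction.orbitRel (Equiv.Perm (Fin n)) X)) :=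
      ⟨fun o => Quotient.inductionOn o fun x => hX.false x⟩
    rw [Fintype.card_eq_zero, zero_mul]

theorem powerSum_eq (K : Type*) [CommRing K] :
    powerSum K = powerSeriesOfWeights K fun c => Finsupp.single c 1 := by
  classical
  funext l m
  refine if_congr (exists_congr fun c => ?_) rfl rfl
  rw [Finsupp.smul_single, smul_eq_mul, mul_one]

theorem coeff_powerSumPart (K : Type*) [CommRing K] {n : ℕ} (σ : Equiv.Perm (Fin n)) (m : ℕ →₀ ℕ) :
    MvPowerSeries.coeff m (powerSumPart K σ.partition.parts) =
      ({f : Fin n → ℕ | f ∘ σ = f ∧ ∑ i, Finsupp.single (f i) 1 = m}.ncard : K) := by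
  rw [powerSumPart, powerSum_eq]
  exact coeff_prod_parts_partition K (Finsupp.single_left_injective one_ne_zero) σ m

/-- The expansion `n! h_n = ∑_σ p_{λ(σ)}` of the complete homogeneous symmetric function. -/
theorem factorial_smul_completeSeries (K : Type*) [CommRing K] (n : ℕ) :
    (n.factorial : K) • completeSeries K n =
      ∑ σ : Equiv.Perm (Fin n), powerSumPart K σ.partition.parts := by
  ext m
  rw [map_sum]
  simp only [coeff_powerSumPart]
  rw [← Nat.cast_sum, sum_ncard_invariant]
  change (n.factorial : K) * (if m.degree = n then 1 else 0) = _
  split_ifs <;> simp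

/-- The geometric series in `X i ^ l`. Coefficientwise, `d` is a multiple of `l` in direction `i`
iff `d` minus `l` is; only the constant term survives. -/
theorem one_sub_X_pow_mul_powerSeriesOfWeights {τ : Type*} (i : τ) (l : ℕ) (hl : l ≠ 0) :
    (1 - MvPowerSeries.X i ^ l) * powerSeriesOfWeights ℂ (fun c => Finsupp.single i c) l = 1 := by
  classical
  ext d
  rw [sub_mul, one_mul, map_sub, MvPowerSeries.X_pow_eq, MvPowerSeries.coeff_monomial_mul,
    MvPowerSeries.coeff_one, one_mul]
  have h : ∀ d, MvPowerSeries.coeff d (powerSeriesOfWeights ℂ (fun c => Finsupp.single i c) l) =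
      if ∃ c, d = Finsupp.single i (l * c) then 1 else 0 := fun d =>
    if_congr (exists_congr fun c => by rw [Finsupp.smul_single, smul_eq_mul]) rfl rfl
  rw [h, h]
  by_cases hd : Finsupp.single i l ≤ d
  · obtain ⟨d, rfl⟩ := exists_add_of_le hd
    have h0 : Finsupp.single i l + d ≠ 0 := by
      intro h0
      have := DFunLike.congr_fun h0 i
      simp at this
      omega
    rw [if_pos hd, add_tsub_cancel_left, if_neg h0, sub_eq_zero]
    refine if_congr ⟨?_, ?_⟩ rfl rfl
    · rintro ⟨c, hc⟩
      rcases c with _ | c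
      · have := DFunLike.congr_fun hc i
        simp at this
        omega
      · refine ⟨c, add_left_cancel (a := Finsupp.single i l) ?_⟩
        rw [hc, ← Finsupp.single_add]
        congr 1
        ring
    · rintro ⟨c, rfl⟩
      refine ⟨c + 1, ?_⟩
      rw [← Finsupp.single_add]
      congr 1
      ring
  · rw [if_neg hd, sub_zero]
    refine if_congr ⟨?_, ?_⟩ rfl rfl
    · rintro ⟨c, rfl⟩
      rcases c with _ | c
      · simp
      · exact absurd (Finsupp.single_le_iff.mpr (by simp [Nat.mul_add])) hd
    · rintro rfl
      exact ⟨0, by simp⟩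

/-- The generating function of the monomials fixed by a permutation, as a product over its
cycles. -/
theorem fixedMonomialSeries_eq {n : ℕ} (σ : Equiv.Perm (Fin n)) :
    fixedMonomialSeries σ =
      (σ.partition.parts.map fun l => ((1 - q ^ l) * (1 - t ^ l))⁻¹).prod := by
  classical
  have hinv : ∀ l ∈ σ.partition.parts, ((1 - q ^ l) * (1 - t ^ l))⁻¹ =
      powerSeriesOfWeights ℂ (fun c => Finsupp.single (0 : Fin 2) c) l *
        powerSeriesOfWeights ℂ (fun c => Finsupp.single (1 : Fin 2) c) l := by
    intro l hl
    have hl0 : l ≠ 0 := (σ.partition.parts_pos hl).ne'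
    rw [MvPowerSeries.inv_eq_iff_mul_eq_one]
    · calc _ = ((1 - MvPowerSeries.X (0 : Fin 2) ^ l) *
            powerSeriesOfWeights ℂ (fun c => Finsupp.single (0 : Fin 2) c) l) *
          ((1 - MvPowerSeries.X (1 : Fin 2) ^ l) *
            powerSeriesOfWeights ℂ (fun c => Finsupp.single (1 : Fin 2) c) l) := by
            rw [q, t]
            ring
        _ = 1 := by
            rw [one_sub_X_pow_mul_powerSeriesOfWeights _ _ hl0,
              one_sub_X_pow_mul_powerSeriesOfWeights _ _ hl0, one_mul]
    · simp [q, t, hl0]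
  rw [Multiset.map_congr rfl hinv, Multiset.prod_map_mul]
  ext d
  rw [MvPowerSeries.coeff_mul]
  have hc : ∀ (i : Fin 2) (d : Fin 2 →₀ ℕ), MvPowerSeries.coeff d (σ.partition.parts.map
      (powerSeriesOfWeights ℂ (fun c => Finsupp.single i c))).prod =
      ({f : Fin n → ℕ | f ∘ σ = f ∧ ∑ j, Finsupp.single i (f j) = d}.ncard : ℂ) := fun i d =>
    coeff_prod_parts_partition ℂ (Finsupp.single_injective i) σ d
  have hsingle : ∀ (i : Fin 2) (f : Fin n → ℕ),
      ∑ j, Finsupp.single i (f j) = Finsupp.single i (∑ j, f j) := fun i f =>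
    (map_sum (Finsupp.singleAddHom i) _ _).symm
  have hzero : ∀ (i : Fin 2) (d : Fin 2 →₀ ℕ), d ≠ Finsupp.single i (d i) →
      {f : Fin n → ℕ | f ∘ σ = f ∧ ∑ j, Finsupp.single i (f j) = d}.ncard = 0 := by
    intro i d hd
    refine (congrArg Set.ncard (Set.eq_empty_iff_forall_notMem.mpr ?_)).trans (Set.ncard_empty _)
    rintro f ⟨-, rfl⟩
    apply hd
    rw [hsingle, Finsupp.single_eq_same]
  have hd : Finsupp.single 0 (d 0) + Finsupp.single 1 (d 1) = d := by
    ext i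
    fin_cases i <;> simp
  simp only [hc]
  -- One factor involves only `q` and the other only `t`, so a single splitting of `d` contributes.
  rw [Finset.sum_eq_single (Finsupp.single 0 (d 0), Finsupp.single 1 (d 1))]
  · rw [← Nat.cast_mul, ← Set.ncard_prod]
    refine congrArg Nat.cast ?_
    -- A pair of `σ`-invariant functions is the pair of exponent vectors, in `x` and in `y`, of a
    -- fixed monomial.
    let Φ : (Fin n → ℕ) × (Fin n → ℕ) → (Fin n ⊕ Fin n) →₀ ℕ := fun p =>
      Finsupp.equivFunOnFinite.symm (Sum.elim p.1 p.2)
    have hl : ∀ p i, Φ p (Sum.inl i) = p.1 i := fun p i => rfl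
    have hr : ∀ p i, Φ p (Sum.inr i) = p.2 i := fun p i => rfl
    have hΦ : Function.Injective Φ := by
      intro p p' h
      refine Prod.ext (funext fun i => ?_) (funext fun i => ?_)
      · rw [← hl, ← hl, h]
      · rw [← hr, ← hr, h]
    rw [← Set.ncard_image_of_injective _ hΦ]
    congr 1
    ext m
    have hm : m.mapDomain (Equiv.sumCongr σ σ) = m ↔
        (fun i => m (Sum.inl i)) ∘ σ = (fun i => m (Sum.inl i)) ∧
          (fun i => m (Sum.inr i)) ∘ σ = fun i => m (Sum.inr i) := by
      have h1 : m.mapDomain (Equiv.sumCongr σ σ) = m ↔ ∀ v, m v = m (Equiv.sumCongr σ σ v) := by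
        constructor
        · intro h v
          conv_rhs => rw [← h]
          rw [Finsupp.mapDomain_apply (Equiv.injective _)]
        · intro h
          ext v
          obtain ⟨v, rfl⟩ := (Equiv.sumCongr σ σ).surjective v
          rw [Finsupp.mapDomain_apply (Equiv.injective _), h]
      rw [h1, Sum.forall, funext_iff, funext_iff]
      exact and_congr (forall_congr' fun i => eq_comm) (forall_congr' fun i => eq_comm)
    change (Finsupp.weight (bidegree n) m = d ∧ _) ↔ _
    rw [hm, weight_bidegree_eq_iff]
    constructor
    · rintro ⟨⟨h0, h1⟩, h2, h3⟩
      refine ⟨(fun i => m (Sum.inl i), fun i => m (Sum.inr i)), ⟨⟨h2, ?_⟩, ⟨h3, ?_⟩⟩, ?_⟩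
      · rw [hsingle, h0]
      · rw [hsingle, h1]
      · ext (i | i) <;> rfl
    · rintro ⟨p, ⟨⟨h2, h0⟩, ⟨h3, h1⟩⟩, rfl⟩
      rw [hsingle] at h0 h1
      exact ⟨⟨Finsupp.single_injective _ h0, Finsupp.single_injective _ h1⟩, h2, h3⟩
  · rintro ⟨a, b⟩ hab hne
    rw [Finset.HasAntidiagonal.mem_antidiagonal] at hab
    dsimp only at hab ⊢
    by_cases ha : a = Finsupp.single 0 (a 0)
    · by_cases hb : b = Finsupp.single 1 (b 1)
      · refine absurd (Prod.ext ?_ ?_) hne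
        · rw [← hab, ha, hb]
          simp
        · rw [← hab, ha, hb]
          simp
      · rw [hzero 1 b hb, Nat.cast_zero, mul_zero]
    · rw [hzero 0 a ha, Nat.cast_zero, zero_mul]
  · intro h
    exact absurd (Finset.HasAntidiagonal.mem_antidiagonal.mpr hd) h

/-! ### The plethysm of `h_n` and the conclusion -/

theorem powerSumEquiv_X (i : ℕ) :
    (powerSumEquiv (MvPolynomial.X i) : MvPowerSeries ℕ QT) = powerSum QT (i + 1) :=
  MvPolynomial.aeval_X _ _

/-- The image under the plethysm of a product of power sums. -/
theorem plethysm_powerSumPart {s : Multiset ℕ} (hs : ∀ l ∈ s, 0 < l) {g : SymmFun QT}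
    (hg : (g : MvPowerSeries ℕ QT) = powerSumPart QT s) :
    plethysm g = (s.map fun l => ((1 - q ^ l) * (1 - t ^ l))⁻¹).prod • powerSumPart QT s := by
  -- The formal variable `i` stands for `p_{i+1}`, so a part `l` has index `l - 1`; positivity of
  -- the parts makes this shift reversible.
  have hg' : g = powerSumEquiv (s.map fun l => MvPolynomial.X (l - 1)).prod := by
    refine Subtype.ext ?_
    rw [hg, powerSumPart, map_multiset_prod, Multiset.map_map]
    refine Eq.trans ?_ (map_multiset_prod (SymmFun QT).val _).symm
    rw [Multiset.map_map]
    refine congrArg Multiset.prod (Multiset.map_congr rfl fun l hl => ?_)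
    refine Eq.trans ?_ (powerSumEquiv_X (l - 1)).symm
    rw [Nat.sub_add_cancel (hs l hl)]
  have h1 : plethysm g = MvPolynomial.aeval (R := QT) (fun i : ℕ =>
      ((1 - q ^ (i + 1)) * (1 - t ^ (i + 1)))⁻¹ • powerSum QT (i + 1))
        (s.map fun l => (MvPolynomial.X (l - 1) : MvPolynomial ℕ QT)).prod := by
    rw [hg', plethysm, AlgHom.comp_apply, AlgEquiv.toAlgHom_apply, AlgEquiv.symm_apply_apply]
  rw [h1, map_multiset_prod, Multiset.map_map, powerSumPart]
  clear h1 hg' hg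
  induction s using Multiset.induction_on with
  | empty => simp
  | cons l s ih =>
    have hl : l - 1 + 1 = l := Nat.sub_add_cancel (hs l (Multiset.mem_cons_self l s))
    rw [Multiset.map_cons, Multiset.prod_cons, ih fun k hk => hs k (Multiset.mem_cons_of_mem hk),
      Multiset.map_cons, Multiset.prod_cons, Multiset.map_cons, Multiset.prod_cons,
      Function.comp_apply, MvPolynomial.aeval_X, hl, smul_mul_smul_comm]

/-- The scalar that the plethysm attaches to `p_{λ(σ)}` is the fixed-monomial series of `σ`. -/
theorem factorial_smul_plethysm_complete (n : ℕ) :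
    (n.factorial : QT) • plethysm (complete n) =
      ∑ σ : Equiv.Perm (Fin n), fixedMonomialSeries σ • powerSumPart QT σ.partition.parts := by
  have hmem : ∀ σ : Equiv.Perm (Fin n), powerSumPart QT σ.partition.parts ∈ SymmFun QT := by
    intro σ
    refine Subalgebra.multiset_prod_mem _ fun p hp => ?_
    obtain ⟨l, hl, rfl⟩ := Multiset.mem_map.mp hp
    refine ⟨MvPolynomial.X (l - 1), ?_⟩
    rw [← Nat.sub_add_cancel (σ.partition.parts_pos hl)]
    exact powerSumEquiv_X _
  have h : (n.factorial : QT) • complete n =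
      ∑ σ : Equiv.Perm (Fin n), (⟨powerSumPart QT σ.partition.parts, hmem σ⟩ : SymmFun QT) := by
    refine Subtype.ext ((factorial_smul_completeSeries QT n).trans ?_)
    rw [AddSubmonoidClass.coe_finsetSum]
  rw [← map_smul, h, map_sum]
  refine Finset.sum_congr rfl fun σ _ => ?_
  rw [plethysm_powerSumPart (fun l hl => σ.partition.parts_pos hl) rfl, fixedMonomialSeries_eq]

theorem factorial_smul_bigradedFrobenius (n : ℕ) :
    (n.factorial : QT) • bigradedFrobenius (harmonics n) =
      (qPoch q n * qPoch t n) • ∑ σ : Equiv.Perm (Fin n),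
        fixedMonomialSeries σ • powerSumPart QT σ.partition.parts := by
  ext m d
  -- The coefficients of `p_{λ(σ)}` are natural numbers, so they can be pulled out of a coefficient
  -- in `q` and `t`.
  have hnat : ∀ (k : ℕ) (A : QT), MvPowerSeries.coeff d (A * (k : QT)) =
      MvPowerSeries.coeff d A * k := by
    intro k A
    rw [mul_comm, ← nsmul_eq_mul, map_nsmul, nsmul_eq_mul, mul_comm]
  have hl : MvPowerSeries.coeff d (MvPowerSeries.coeff m ((n.factorial : QT) •
      bigradedFrobenius (harmonics n))) = (n.factorial : ℂ) *
        MvPowerSeries.coeff m (frobenius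
          (component (harmonics n) (d 0) (d 1)).toRepresentation) := by
    rw [MvPowerSeries.coeff_smul, mul_comm, hnat, mul_comm]
    rfl
  rw [hl, frobenius, MvPowerSeries.coeff_smul, mul_inv_cancel_left₀
    (by exact_mod_cast n.factorial_ne_zero), Finset.smul_sum, map_sum, map_sum, map_sum]
  refine Finset.sum_congr rfl fun σ _ => ?_
  rw [MvPowerSeries.coeff_smul, smul_smul, MvPowerSeries.coeff_smul, coeff_powerSumPart,
    coeff_powerSumPart, hnat, character_component_harmonics]

theorem bigradedFrobenius_harmonics (n : ℕ) :
    bigradedFrobenius (harmonics n) = (qPoch q n * qPoch t n) • plethysm (complete n) := by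
  have hn : (n.factorial : QT) ≠ 0 := by exact_mod_cast n.factorial_ne_zero
  have h : (n.factorial : QT) • bigradedFrobenius (harmonics n) =
      (n.factorial : QT) • (qPoch q n * qPoch t n) • plethysm (complete n) := by
    rw [factorial_smul_bigradedFrobenius, smul_comm, factorial_smul_plethysm_complete]
  ext1 m
  have h1 := congrArg (MvPowerSeries.coeff m) h
  rw [MvPowerSeries.coeff_smul, MvPowerSeries.coeff_smul] at h1
  exact mul_left_cancel₀ hn h1

end BigradedFrobenius

theorem mainTheorem1 (n : ℕ) :
    BigradedFrobenius.bigradedFrobenius (BigradedFrobenius.harmonics n) =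
      (BigradedFrobenius.qPoch BigradedFrobenius.q n *
        BigradedFrobenius.qPoch BigradedFrobenius.t n) •
        BigradedFrobenius.plethysm (BigradedFrobenius.complete n) :=
  BigradedFrobenius.bigradedFrobenius_harmonics n
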